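/- Let $N\ge 2$ and let $q>2$ be subcritical, that is $q<\frac{2N}{N-2}$ if $N\ge 3$, and $q<\infty$ if $N=2$. For an open set $E\subseteq\mathbb{R}^N$ put \[ \lambda_{2,q}(E)=\inf\Big\{\int_E|\nabla\varphi|^2\,dx\ :\ \varphi\in C^\infty_0(E),\ \|\varphi\|_{L^q(E)}=1\Big\}\in[0,+\infty], \] with the convention $\inf\emptyset=+\infty$, and let the constant at infinity be \[ \mathcal{E}_{2,q}(E)=\sup_{R>0}\lambda_{2,q}\big(E\setminus\overline{B_R}\big), \] where $B_R$ is the ball of radius $R$ centered at the origin. Let $\Omega\subseteq\mathbb{R}^N$ be an open set such that \[ \lambda_{2,q}(\Omega)<\mathcal{E}_{2,q}(\Omega). \] Then there exists an extremal for $\lambda_{2,q}(\Omega)$, i.e. a real-valued function $u\in W^{1,2}_0(\Omega)\cap L^q(\Omega)$, $u\not\equiv 0$, such that \[ \int_\Omega|\nabla u|^2\,dx=\lambda_{2,q}(\Omega)\,\left(\int_\Omega|u|^q\,dx\right)^{\frac{2}{q}}. \] Here $W^{1,2}_0(\Omega)$ is the closure of $C^\infty_0(\Omega)$ in the Sobolev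 space $W^{1,2}(\Omega)$. -/

import Mathlib

open MeasureTheory Filter Topology
open scoped ENNReal ContDiff

noncomputable section

/-- `φ ∈ C₀^∞(Ω)`: `φ` is smooth with compact support contained in `Ω`. -/
def IsTestFunction {N : ℕ} (Ω : Set (EuclideanSpace ℝ (Fin N)))
    (φ : EuclideanSpace ℝ (Fin N) → ℝ) : Prop :=
  ContDiff ℝ ∞ φ ∧ HasCompactSupport φ ∧ tsupport φ ⊆ Ω

/-- `G` is a weak (distributional) gradient of `u` in `Ω`. -/
def IsWeakGradient {N : ℕ} (Ω : Set (EuclideanSpace ℝ (Fin N)))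
    (u : EuclideanSpace ℝ (Fin N) → ℝ)
    (G : EuclideanSpace ℝ (Fin N) → EuclideanSpace ℝ (Fin N)) : Prop :=
  ∀ φ, IsTestFunction Ω φ →
    ∫ x in Ω, u x • gradient φ x = - ∫ x in Ω, φ x • G x

/-- `u ∈ W^{1,p}(Ω)`, with weak gradient `G`. -/
structure MemW1 {N : ℕ} (p : ℝ) (Ω : Set (EuclideanSpace ℝ (Fin N)))
    (u : EuclideanSpace ℝ (Fin N) → ℝ)
    (G : EuclideanSpace ℝ (Fin N) → EuclideanSpace ℝ (Fin N)) : Prop where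
  memLp : MemLp u (ENNReal.ofReal p) (volume.restrict Ω)
  memLp_grad : MemLp G (ENNReal.ofReal p) (volume.restrict Ω)
  isWeakGradient : IsWeakGradient Ω u G

/-- `u ∈ W₀^{1,p}(Ω)`, with weak gradient `G`: the function `u ∈ W^{1,p}(Ω)` is a limit of
functions of `C₀^∞(Ω)` in the norm `‖u‖_{L^p(Ω)} + ‖∇u‖_{L^p(Ω)}`. -/
structure MemW1Zero {N : ℕ} (p : ℝ) (Ω : Set (EuclideanSpace ℝ (Fin N)))
    (u : EuclideanSpace ℝ (Fin N) → ℝ)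
    (G : EuclideanSpace ℝ (Fin N) → EuclideanSpace ℝ (Fin N)) : Prop extends
    MemW1 p Ω u G where
  exists_approx : ∃ φ : ℕ → EuclideanSpace ℝ (Fin N) → ℝ,
    (∀ n, IsTestFunction Ω (φ n)) ∧
    Tendsto (fun n => eLpNorm (fun x => φ n x - u x) (ENNReal.ofReal p) (volume.restrict Ω))
      atTop (𝓝 0) ∧
    Tendsto (fun n => eLpNorm (fun x => gradient (φ n) x - G x) (ENNReal.ofReal p)
      (volume.restrict Ω)) atTop (𝓝 0)

/-- The sharp Poincaré–Sobolev constant `λ_{p,q}(Ω)`, the infimum of `∫_Ω |∇φ|^p` over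
`φ ∈ C₀^∞(Ω)` with `‖φ‖_{L^q(Ω)} = 1`; it is `+∞` if there is no such `φ`. -/
def poincareSobolev {N : ℕ} (p : ℝ) (q : ℝ≥0∞) (Ω : Set (EuclideanSpace ℝ (Fin N))) : ℝ≥0∞ :=
  ⨅ (φ : EuclideanSpace ℝ (Fin N) → ℝ) (_ : IsTestFunction Ω φ)
    (_ : eLpNorm φ q (volume.restrict Ω) = 1), ∫⁻ x in Ω, ‖gradient φ x‖ₑ ^ p

/-- The Poincaré–Sobolev constant at infinity,
`𝓔_{p,q}(Ω) = sup_{R > 0} λ_{p,q}(Ω ∖ closure B_R)`. -/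
def poincareSobolevAtInfinity {N : ℕ} (p : ℝ) (q : ℝ≥0∞)
    (Ω : Set (EuclideanSpace ℝ (Fin N))) : ℝ≥0∞ :=
  ⨆ (R : ℝ) (_ : 0 < R), poincareSobolev p q (Ω \ Metric.closedBall 0 R)

/-- `q` is subcritical for the Sobolev embedding in dimension `N` with exponent `p`:
`q < Np/(N-p)` if `p < N`, `q < ∞` if `p = N`, and `q ≤ ∞` if `p > N`. -/
def IsSubcritical (N : ℕ) (p : ℝ) (q : ℝ≥0∞) : Prop :=
  (p < N → q < ENNReal.ofReal (N * p / (N - p))) ∧ (p = N → q < ⊤)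

/-- `u` is an extremal for `λ_{p,q}(Ω)`: `u ∈ W₀^{1,p}(Ω) ∖ {0}` lies in `L^q(Ω)` and
`∫_Ω |∇u|^p = λ_{p,q}(Ω) ‖u‖_{L^q(Ω)}^p`. -/
def IsExtremal {N : ℕ} (p : ℝ) (q : ℝ≥0∞) (Ω : Set (EuclideanSpace ℝ (Fin N)))
    (u : EuclideanSpace ℝ (Fin N) → ℝ) : Prop :=
  ¬ (u =ᵐ[volume.restrict Ω] 0) ∧ MemLp u q (volume.restrict Ω) ∧
  ∃ G, MemW1Zero p Ω u G ∧
    ∫⁻ x in Ω, ‖G x‖ₑ ^ p = poincareSobolev p q Ω * eLpNorm u q (volume.restrict Ω) ^ p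

end

/-! The gap between the two constants prevents a minimizing sequence from losing `L^q` mass at
infinity, and subcriticality prevents concentration. A minimizing sequence therefore has a
subsequence that converges strongly. The proof shows directly that the subsequence is Cauchy, so no
weak limit of gradients has to be identified.

Write `l` for the constant of `Ω` and choose a real `c > l` not exceeding the constant of `Ω`
outside some ball `B_R`. Since `c > 0`, subcriticality turns Poincaré–Sobolev outside the ball into
a Poincaré inequality there. This bounds the `L²` norm of test functions in `Ω` by the gradient and
the `L^q` norm (`exists_lpNorm_two_sq_le_add`), so minimizing sequences normalized in `L^q` are
bounded in `W^{1,2}`. Rellich (`exists_subseq_tendsto_setIntegral_sq_sub`) then gives a subsequence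
that is Cauchy in `L²` of every ball, and interpolation with a Sobolev norm of exponent above `q`
upgrades this to local `L^q` (`IsCutoffAngle.tendsto_lpNorm_cos_mul`).

Mass at infinity is controlled with the partition `cos² θ + sin² θ = 1` at scale `S > R`. The energy
splits with an error of order `S⁻²`, the inner piece costs at least `l` and the outer piece at least
`c` times its squared `L^q` norm, and these squared norms add up to at least one because `q ≥ 2`. So
`c - l` times the outer part is at most the energy excess plus the error
(`IsCutoffAngle.mul_lpNorm_sin_sq_le`), and the sequence is Cauchy in `L^q` (`tendsto_lpNorm_sub`).

Finally, the sum of two late terms has `L^q` norm close to 2, hence energy at least about `4 * l`.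
The parallelogram law then makes the gradients Cauchy in `L²`
(`IsTestFunction.lpNorm_gradient_sub_sq_le`), and the Poincaré bound makes the functions Cauchy in
`L²`. The limit is an extremal. -/

/-- Euclidean space of dimension `N`. -/
abbrev Euc (N : ℕ) := EuclideanSpace ℝ (Fin N)

/-! ### Gradient calculus, `L²` norms and test functions -/

section Gradient

variable {N : ℕ} {f g : Euc N → ℝ} {x : Euc N}

lemma HasGradientAt.sub' {f' g' : Euc N} (hf : HasGradientAt f f' x) (hg : HasGradientAt g g' x) :
    HasGradientAt (fun y => f y - g y) (f' - g') x := by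
  rw [hasGradientAt_iff_hasFDerivAt] at *
  rw [map_sub]
  exact hf.fun_sub hg

lemma HasGradientAt.add' {f' g' : Euc N} (hf : HasGradientAt f f' x) (hg : HasGradientAt g g' x) :
    HasGradientAt (fun y => f y + g y) (f' + g') x := by
  rw [hasGradientAt_iff_hasFDerivAt] at *
  rw [map_add]
  exact hf.fun_add hg

lemma HasGradientAt.const_mul' {f' : Euc N} (hf : HasGradientAt f f' x) (c : ℝ) :
    HasGradientAt (fun y => c * f y) (c • f') x := by
  rw [hasGradientAt_iff_hasFDerivAt] at *
  simpa using hf.const_mul c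

lemma HasGradientAt.mul' {f' g' : Euc N} (hf : HasGradientAt f f' x) (hg : HasGradientAt g g' x) :
    HasGradientAt (fun y => f y * g y) (f x • g' + g x • f') x := by
  rw [hasGradientAt_iff_hasFDerivAt] at *
  rw [map_add, map_smul, map_smul]
  exact hf.fun_mul hg

lemma HasGradientAt.scomp {h : ℝ → ℝ} {h' : ℝ} {f' : Euc N} (hf : HasGradientAt f f' x)
    (hh : HasDerivAt h h' (f x)) : HasGradientAt (fun y => h (f y)) (h' • f') x := by
  rw [hasGradientAt_iff_hasFDerivAt] at *
  rw [map_smul]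
  exact hh.comp_hasFDerivAt x hf

lemma norm_gradient (f : Euc N → ℝ) (x : Euc N) : ‖gradient f x‖ = ‖fderiv ℝ f x‖ := by
  rw [← toDual_gradient, LinearIsometryEquiv.norm_map]

lemma ContDiff.continuous_gradient (hf : ContDiff ℝ ∞ f) : Continuous (gradient f) :=
  (LinearIsometryEquiv.continuous _).comp (hf.continuous_fderiv (by simp))

lemma ContDiff.hasGradientAt (hf : ContDiff ℝ ∞ f) (x : Euc N) :
    HasGradientAt f (gradient f x) x :=
  (hf.differentiable (by simp) x).hasGradientAt

end Gradient

section Lp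

variable {α F : Type*} [MeasurableSpace α] [NormedAddCommGroup F] {μ : Measure α}

lemma lpNorm_two_sq {f : α → F} (hf : MemLp f 2 μ) : lpNorm f 2 μ ^ 2 = ∫ x, ‖f x‖ ^ 2 ∂μ := by
  rw [lpNorm_eq_integral_norm_rpow_toReal (by simp) (by simp) hf.1]
  simp only [ENNReal.toReal_ofNat, Real.rpow_ofNat]
  rw [← Real.rpow_natCast, ← Real.rpow_mul (integral_nonneg fun _ => by positivity)]
  norm_num

lemma ofReal_lpNorm_two_sq {f : α → F} (hf : MemLp f 2 μ) :
    ENNReal.ofReal (lpNorm f 2 μ ^ 2) = ∫⁻ x, ‖f x‖ₑ ^ (2 : ℝ) ∂μ := by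
  rw [ENNReal.ofReal_pow lpNorm_nonneg, ofReal_lpNorm hf,
    eLpNorm_eq_lintegral_rpow_enorm_toReal (by simp) (by simp)]
  simp only [ENNReal.toReal_ofNat]
  rw [← ENNReal.rpow_natCast, ← ENNReal.rpow_mul]
  norm_num

lemma lpNorm_mono {p : ℝ≥0∞} {G : Type*} [NormedAddCommGroup G] {f : α → F} {g : α → G}
    (hf : MemLp f p μ) (hg : MemLp g p μ) (h : ∀ x, ‖f x‖ ≤ ‖g x‖) : lpNorm f p μ ≤ lpNorm g p μ := by
  rw [← toReal_eLpNorm hf.1, ← toReal_eLpNorm hg.1]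
  exact ENNReal.toReal_mono hg.eLpNorm_ne_top (eLpNorm_mono h)

end Lp

namespace IsTestFunction

variable {N : ℕ} {U : Set (Euc N)} {φ ψ : Euc N → ℝ}

lemma contDiff (h : IsTestFunction U φ) : ContDiff ℝ ∞ φ := h.1

lemma memLp (h : IsTestFunction U φ) (p : ℝ≥0∞) : MemLp φ p volume :=
  h.1.continuous.memLp_of_hasCompactSupport h.2.1

lemma tsupport_gradient_subset (φ : Euc N → ℝ) : tsupport (gradient φ) ⊆ tsupport φ := by
  have : Function.support (gradient φ) = Function.support (fderiv ℝ φ) := by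
    ext x
    rw [Function.mem_support, Function.mem_support, ← norm_ne_zero_iff, norm_gradient,
      norm_ne_zero_iff]
  rw [tsupport, this]
  exact tsupport_fderiv_subset ℝ

lemma hasCompactSupport_gradient (h : IsTestFunction U φ) : HasCompactSupport (gradient φ) :=
  h.2.1.of_isClosed_subset (isClosed_tsupport _) (tsupport_gradient_subset φ)

lemma memLp_gradient (h : IsTestFunction U φ) (p : ℝ≥0∞) : MemLp (gradient φ) p volume :=
  h.1.continuous_gradient.memLp_of_hasCompactSupport h.hasCompactSupport_gradient

lemma support_subset (h : IsTestFunction U φ) : Function.support φ ⊆ U :=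
  (subset_tsupport φ).trans h.2.2

lemma support_gradient_subset (h : IsTestFunction U φ) : Function.support (gradient φ) ⊆ U :=
  (subset_tsupport _).trans ((tsupport_gradient_subset φ).trans h.2.2)

lemma sub (h : IsTestFunction U φ) (h' : IsTestFunction U ψ) :
    IsTestFunction U (fun x => φ x - ψ x) := by
  refine ⟨h.1.sub h'.1, h.2.1.sub h'.2.1, ?_⟩
  exact (tsupport_sub φ ψ).trans (Set.union_subset h.2.2 h'.2.2)

lemma add (h : IsTestFunction U φ) (h' : IsTestFunction U ψ) :
    IsTestFunction U (fun x => φ x + ψ x) := by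
  refine ⟨h.1.add h'.1, h.2.1.add h'.2.1, ?_⟩
  exact (tsupport_add φ ψ).trans (Set.union_subset h.2.2 h'.2.2)

lemma smooth_mul (h : IsTestFunction U φ) {f : Euc N → ℝ} (hf : ContDiff ℝ ∞ f) :
    IsTestFunction U (fun x => f x * φ x) :=
  ⟨hf.mul h.1, h.2.1.mul_left, (tsupport_mul_subset_right).trans h.2.2⟩

lemma const_mul (h : IsTestFunction U φ) (c : ℝ) : IsTestFunction U (fun x => c * φ x) :=
  h.smooth_mul contDiff_const

lemma gradient_sub (h : IsTestFunction U φ) (h' : IsTestFunction U ψ) :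
    gradient (fun x => φ x - ψ x) = fun x => gradient φ x - gradient ψ x :=
  funext fun x => ((h.1.hasGradientAt x).sub' (h'.1.hasGradientAt x)).gradient

lemma gradient_add (h : IsTestFunction U φ) (h' : IsTestFunction U ψ) :
    gradient (fun x => φ x + ψ x) = fun x => gradient φ x + gradient ψ x :=
  funext fun x => ((h.1.hasGradientAt x).add' (h'.1.hasGradientAt x)).gradient

lemma gradient_const_mul (h : IsTestFunction U φ) (c : ℝ) :
    gradient (fun x => c * φ x) = fun x => c • gradient φ x :=
  funext fun x => ((h.1.hasGradientAt x).const_mul' c).gradient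

/-- The Poincaré–Sobolev inequality, for any constant below the sharp one. -/
lemma mul_lpNorm_sq_le {q : ℝ≥0∞} (h : IsTestFunction U φ) {c : ℝ}
    (hcU : ENNReal.ofReal c ≤ poincareSobolev 2 q U) :
    c * lpNorm φ q volume ^ 2 ≤ lpNorm (gradient φ) 2 volume ^ 2 := by
  -- A function of zero norm cannot be normalized, but then the left side vanishes.
  rcases (lpNorm_nonneg (f := φ) (p := q) (μ := volume)).eq_or_lt with h0 | h0
  · rw [← h0]; simp
  set a := lpNorm φ q volume with ha
  have hψ := h.const_mul a⁻¹
  have h1 : eLpNorm (fun x => a⁻¹ * φ x) q (volume.restrict U) = 1 := by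
    rw [eLpNorm_restrict_eq_of_support_subset hψ.support_subset, ← ofReal_lpNorm (hψ.memLp q)]
    have : lpNorm (fun x => a⁻¹ * φ x) q volume = 1 := by
      have := lpNorm_const_smul (p := q) a⁻¹ φ volume
      rw [Pi.smul_def] at this
      simp only [smul_eq_mul] at this
      rw [this, ← ha, coe_nnnorm, Real.norm_eq_abs, abs_of_pos (by positivity)]
      field_simp
    simp [this]
  have h2 : ENNReal.ofReal c ≤ ENNReal.ofReal (lpNorm (gradient fun x => a⁻¹ * φ x) 2 volume ^ 2) := by
    rw [ofReal_lpNorm_two_sq (hψ.memLp_gradient 2)]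
    exact hcU.trans ((iInf₂_le_of_le _ hψ (iInf_le _ h1)).trans
      (lintegral_mono' Measure.restrict_le_self le_rfl))
  rw [ENNReal.ofReal_le_ofReal_iff (by positivity), h.gradient_const_mul] at h2
  have := lpNorm_const_smul (p := 2) a⁻¹ (gradient φ) volume
  rw [Pi.smul_def] at this
  rw [this, coe_nnnorm, Real.norm_eq_abs, abs_of_pos (by positivity), mul_pow, inv_pow,
    inv_mul_eq_div, le_div_iff₀ (by positivity)] at h2
  exact h2

end IsTestFunction

/-! ### Cutoff angles and localization of the energy -/

/-- A smooth angle which vanishes on the ball of radius `S`, equals `π / 2` off the ball of radius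
`2 * S`, and has gradient at most `L / S`. Its cosine and sine form a quadratic partition of
unity. -/
structure IsCutoffAngle {N : ℕ} (L S : ℝ) (θ : Euc N → ℝ) : Prop where
  contDiff : ContDiff ℝ ∞ θ
  nonneg : ∀ x, 0 ≤ θ x
  le_pi_div_two : ∀ x, θ x ≤ Real.pi / 2
  eq_zero : ∀ x, ‖x‖ ≤ S → θ x = 0
  eq_pi_div_two : ∀ x, 2 * S ≤ ‖x‖ → θ x = Real.pi / 2
  norm_gradient_le : ∀ x, ‖gradient θ x‖ ≤ L / S

lemma exists_isCutoffAngle (N : ℕ) :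
    ∃ L : ℝ, 0 < L ∧ ∀ S : ℝ, 0 < S → ∃ θ : Euc N → ℝ, IsCutoffAngle L S θ := by
  let b : ContDiffBump (0 : Euc N) := ⟨1, 2, by norm_num, by norm_num⟩
  have hb : ContDiff ℝ ∞ b := b.contDiff
  obtain ⟨M, hM⟩ := (b.hasCompactSupport.fderiv ℝ).exists_bound_of_continuous
    (hb.continuous_fderiv (by simp))
  have hM0 : 0 ≤ M := (norm_nonneg _).trans (hM 0)
  -- The summand 1 only serves to make the constant positive when `M` is zero.
  refine ⟨Real.pi / 2 * M + 1, by positivity, fun S hS => ?_⟩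
  have hder : ∀ x : Euc N, HasFDerivAt (fun x : Euc N => Real.pi / 2 * (1 - b (S⁻¹ • x)))
      ((Real.pi / 2) • -((fderiv ℝ b (S⁻¹ • x)).comp (S⁻¹ • ContinuousLinearMap.id ℝ (Euc N)))) x := by
    intro x
    have h1 : HasFDerivAt (fun x : Euc N => S⁻¹ • x) (S⁻¹ • ContinuousLinearMap.id ℝ (Euc N)) x :=
      (hasFDerivAt_id x).const_smul S⁻¹
    have h2 : HasFDerivAt b (fderiv ℝ b (S⁻¹ • x)) (S⁻¹ • x) :=
      (hb.differentiable (by simp) _).hasFDerivAt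
    exact ((h2.comp x h1).const_sub 1).const_mul (Real.pi / 2)
  refine ⟨fun x => Real.pi / 2 * (1 - b (S⁻¹ • x)), ?_, ?_, ?_, ?_, ?_, ?_⟩
  · exact contDiff_const.mul (contDiff_const.sub (hb.comp (contDiff_const_smul S⁻¹)))
  · intro x
    have := b.le_one (x := S⁻¹ • x)
    have := Real.pi_pos
    exact mul_nonneg (by positivity) (by linarith)
  · intro x
    have := b.nonneg (x := S⁻¹ • x)
    have := Real.pi_pos
    nlinarith
  · intro x hx
    have : b (S⁻¹ • x) = 1 := by
      apply b.one_of_mem_closedBall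
      rw [mem_closedBall_zero_iff, norm_smul, norm_inv, Real.norm_eq_abs, abs_of_pos hS,
        inv_mul_le_iff₀ hS]
      simpa [b] using hx
    simp [this]
  · intro x hx
    have : b (S⁻¹ • x) = 0 := by
      apply b.zero_of_le_dist
      rw [dist_zero_right, norm_smul, norm_inv, Real.norm_eq_abs, abs_of_pos hS,
        le_inv_mul_iff₀ hS]
      simpa [b, mul_comm] using hx
    simp [this]
  · intro x
    rw [norm_gradient, (hder x).fderiv, norm_smul, norm_neg, Real.norm_eq_abs,
      abs_of_pos (by positivity)]
    have h3 : ‖(fderiv ℝ b (S⁻¹ • x)).comp (S⁻¹ • ContinuousLinearMap.id ℝ (Euc N))‖ ≤ M * S⁻¹ := by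
      refine (ContinuousLinearMap.opNorm_comp_le _ _).trans ?_
      refine mul_le_mul (hM _) ?_ (norm_nonneg _) hM0
      refine (norm_smul_le S⁻¹ (ContinuousLinearMap.id ℝ (Euc N))).trans ?_
      rw [norm_inv, Real.norm_eq_abs, abs_of_pos hS]
      exact mul_le_of_le_one_right (by positivity) ContinuousLinearMap.norm_id_le
    have hp : 0 ≤ Real.pi / 2 := by positivity
    calc Real.pi / 2 * _ ≤ Real.pi / 2 * (M * S⁻¹) := by gcongr
      _ ≤ (Real.pi / 2 * M + 1) / S := by
        rw [div_eq_mul_inv, ← mul_assoc]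
        exact mul_le_mul_of_nonneg_right (by linarith) (by positivity)

section Rotation

variable {N : ℕ} {U : Set (Euc N)} {φ θ : Euc N → ℝ}

lemma gradient_cos_mul (hφ : ContDiff ℝ ∞ φ) (hθ : ContDiff ℝ ∞ θ) (x : Euc N) :
    gradient (fun y => Real.cos (θ y) * φ y) x
      = Real.cos (θ x) • gradient φ x - (φ x * Real.sin (θ x)) • gradient θ x := by
  rw [(((hθ.hasGradientAt x).scomp (Real.hasDerivAt_cos _)).mul' (hφ.hasGradientAt x)).gradient,
    smul_smul, mul_neg, neg_smul, sub_eq_add_neg]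

lemma gradient_sin_mul (hφ : ContDiff ℝ ∞ φ) (hθ : ContDiff ℝ ∞ θ) (x : Euc N) :
    gradient (fun y => Real.sin (θ y) * φ y) x
      = Real.sin (θ x) • gradient φ x + (φ x * Real.cos (θ x)) • gradient θ x := by
  rw [(((hθ.hasGradientAt x).scomp (Real.hasDerivAt_sin _)).mul' (hφ.hasGradientAt x)).gradient,
    smul_smul]

/-- The pointwise localization formula for a quadratic partition of unity. -/
lemma norm_gradient_cos_mul_sq_add_sin (hφ : ContDiff ℝ ∞ φ) (hθ : ContDiff ℝ ∞ θ) (x : Euc N) :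
    ‖gradient (fun y => Real.cos (θ y) * φ y) x‖ ^ 2
      + ‖gradient (fun y => Real.sin (θ y) * φ y) x‖ ^ 2
      = ‖gradient φ x‖ ^ 2 + φ x ^ 2 * ‖gradient θ x‖ ^ 2 := by
  -- The pair of gradients is a rotation by `θ` of the pair formed by the gradient of `φ` and `φ`
  -- times that of `θ`, so the cross terms cancel.
  rw [gradient_cos_mul hφ hθ, gradient_sin_mul hφ hθ, norm_add_sq_real, norm_sub_sq_real]
  simp only [norm_smul, real_inner_smul_left, real_inner_smul_right, mul_pow, Real.norm_eq_abs,
    sq_abs]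
  linear_combination (‖gradient φ x‖ ^ 2 + φ x ^ 2 * ‖gradient θ x‖ ^ 2) *
    Real.sin_sq_add_cos_sq (θ x)

lemma IsTestFunction.cos_mul (h : IsTestFunction U φ) (hθ : ContDiff ℝ ∞ θ) :
    IsTestFunction U (fun x => Real.cos (θ x) * φ x) :=
  h.smooth_mul (Real.contDiff_cos.comp hθ)

lemma IsTestFunction.sin_mul (h : IsTestFunction U φ) (hθ : ContDiff ℝ ∞ θ) :
    IsTestFunction U (fun x => Real.sin (θ x) * φ x) :=
  h.smooth_mul (Real.contDiff_sin.comp hθ)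

lemma IsTestFunction.integrable_sq (h : IsTestFunction U φ) :
    Integrable (fun x => φ x ^ 2) volume :=
  (h.memLp 2).integrable_sq

lemma IsTestFunction.integrable_gradient_sq (h : IsTestFunction U φ) :
    Integrable (fun x => ‖gradient φ x‖ ^ 2) volume :=
  (h.memLp_gradient 2).integrable_norm_pow (by simp)

lemma IsTestFunction.lpNorm_sq (h : IsTestFunction U φ) :
    lpNorm φ 2 volume ^ 2 = ∫ x, φ x ^ 2 := by
  rw [lpNorm_two_sq (h.memLp 2)]
  simp

lemma IsTestFunction.lpNorm_gradient_sq (h : IsTestFunction U φ) :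
    lpNorm (gradient φ) 2 volume ^ 2 = ∫ x, ‖gradient φ x‖ ^ 2 :=
  lpNorm_two_sq (h.memLp_gradient 2)

lemma IsTestFunction.lpNorm_cos_sq_add_sin (h : IsTestFunction U φ) (hθ : ContDiff ℝ ∞ θ) :
    lpNorm (fun x => Real.cos (θ x) * φ x) 2 volume ^ 2
      + lpNorm (fun x => Real.sin (θ x) * φ x) 2 volume ^ 2 = lpNorm φ 2 volume ^ 2 := by
  rw [(h.cos_mul hθ).lpNorm_sq, (h.sin_mul hθ).lpNorm_sq, h.lpNorm_sq,
    ← integral_add (h.cos_mul hθ).integrable_sq (h.sin_mul hθ).integrable_sq]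
  congr 1 with x
  linear_combination φ x ^ 2 * Real.sin_sq_add_cos_sq (θ x)

end Rotation

namespace IsCutoffAngle

variable {N : ℕ} {L S : ℝ} {U : Set (Euc N)} {φ θ : Euc N → ℝ}

lemma gradient_eq_zero (h : IsCutoffAngle L S θ) {x : Euc N} (hx : 2 * S < ‖x‖) :
    gradient θ x = 0 := by
  have : θ =ᶠ[𝓝 x] fun _ => Real.pi / 2 := by
    filter_upwards [(isOpen_lt continuous_const continuous_norm).mem_nhds hx] with y hy
    exact h.eq_pi_div_two y hy.le
  rw [this.gradient_eq, gradient_fun_const]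

lemma norm_gradient_sq_le (h : IsCutoffAngle L S θ) (x : Euc N) :
    ‖gradient θ x‖ ^ 2 ≤ (Metric.closedBall 0 (2 * S)).indicator (fun _ => (L / S) ^ 2) x := by
  by_cases hx : x ∈ Metric.closedBall 0 (2 * S)
  · rw [Set.indicator_of_mem hx]
    gcongr
    exact h.norm_gradient_le x
  · rw [Set.indicator_of_notMem hx, h.gradient_eq_zero (by simpa using hx)]
    simp

/-- The localization formula for a quadratic partition of unity, in integrated form. -/
lemma lpNorm_gradient_le (h : IsCutoffAngle L S θ)
    (hφ : IsTestFunction U φ) :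
    lpNorm (gradient fun x => Real.cos (θ x) * φ x) 2 volume ^ 2
      + lpNorm (gradient fun x => Real.sin (θ x) * φ x) 2 volume ^ 2
      ≤ lpNorm (gradient φ) 2 volume ^ 2
        + (L / S) ^ 2 * ∫ x in Metric.closedBall 0 (2 * S), φ x ^ 2 := by
  have hc := hφ.cos_mul h.contDiff
  have hs := hφ.sin_mul h.contDiff
  rw [hc.lpNorm_gradient_sq, hs.lpNorm_gradient_sq, hφ.lpNorm_gradient_sq,
    ← integral_add hc.integrable_gradient_sq hs.integrable_gradient_sq,
    ← integral_const_mul, ← integral_indicator measurableSet_closedBall, ← integral_add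
    hφ.integrable_gradient_sq ((hφ.integrable_sq.const_mul _).indicator measurableSet_closedBall)]
  refine integral_mono (hc.integrable_gradient_sq.add hs.integrable_gradient_sq)
    (hφ.integrable_gradient_sq.add
      ((hφ.integrable_sq.const_mul _).indicator measurableSet_closedBall)) fun x => ?_
  simp only []
  rw [norm_gradient_cos_mul_sq_add_sin hφ.contDiff h.contDiff]
  have := h.norm_gradient_sq_le x
  by_cases hx : x ∈ Metric.closedBall 0 (2 * S)
  · rw [Set.indicator_of_mem hx] at this ⊢
    nlinarith [sq_nonneg (φ x)]
  · rw [Set.indicator_of_notMem hx] at this ⊢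
    nlinarith [sq_nonneg (φ x)]

lemma cos_eq_zero (h : IsCutoffAngle L S θ) {x : Euc N} (hx : 2 * S ≤ ‖x‖) :
    Real.cos (θ x) = 0 := by
  rw [h.eq_pi_div_two x hx, Real.cos_pi_div_two]

lemma cos_nonneg (h : IsCutoffAngle L S θ) (x : Euc N) : 0 ≤ Real.cos (θ x) :=
  Real.cos_nonneg_of_neg_pi_div_two_le_of_le (by linarith [h.nonneg x, Real.pi_pos])
    (h.le_pi_div_two x)

lemma sin_nonneg (h : IsCutoffAngle L S θ) (x : Euc N) : 0 ≤ Real.sin (θ x) :=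
  Real.sin_nonneg_of_nonneg_of_le_pi (h.nonneg x) (by linarith [h.le_pi_div_two x, Real.pi_pos])

/-- On the first quadrant the sum of sine and cosine has square at least one. This lets the sine
piece dominate what the cosine cutoff leaves behind. -/
lemma one_sub_cos_le (h : IsCutoffAngle L S θ) (x : Euc N) :
    1 - Real.cos (θ x) ≤ Real.sin (θ x) := by
  nlinarith [h.cos_nonneg x, h.sin_nonneg x, Real.sin_sq_add_cos_sq (θ x)]

/-- The strict inequality `R < S` gives each point of the closed ball a neighbourhood on which the
product vanishes, so the closed support avoids the ball. -/
lemma isTestFunction_sin_mul (h : IsCutoffAngle L S θ) {R : ℝ} (hR : R < S)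
    (hφ : IsTestFunction U φ) :
    IsTestFunction (U \ Metric.closedBall 0 R) (fun x => Real.sin (θ x) * φ x) := by
  have h1 := hφ.sin_mul h.contDiff
  refine ⟨h1.1, h1.2.1, fun x hx => ⟨h1.2.2 hx, fun hxR => ?_⟩⟩
  have h2 : (fun x => Real.sin (θ x) * φ x) =ᶠ[𝓝 x] 0 := by
    filter_upwards [(isOpen_lt continuous_norm continuous_const).mem_nhds
      ((mem_closedBall_zero_iff.1 hxR).trans_lt hR)] with y hy
    simp [h.eq_zero y hy.le]
  exact (notMem_tsupport_iff_eventuallyEq.2 h2) hx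

end IsCutoffAngle

/-! ### From Poincaré–Sobolev to Poincaré -/

/-- Hölder's inequality on a set of finite measure. -/
lemma setIntegral_sq_le_lpNorm {α : Type*} [MeasurableSpace α] {μ : Measure α} {f : α → ℝ}
    {q : ℝ≥0∞} (hq : 2 ≤ q) (hf2 : MemLp f 2 μ) (hf : MemLp f q μ) {s : Set α} (hs : μ s ≠ ⊤) :
    ∫ x in s, f x ^ 2 ∂μ ≤ μ.real s ^ (1 - 2 / q.toReal) * lpNorm f q μ ^ 2 := by
  have h1 := eLpNorm_le_eLpNorm_mul_rpow_measure_univ hq (hf.1.restrict (s := s))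
  have h2 : lpNorm f 2 (μ.restrict s) ≤ lpNorm f q μ * μ.real s ^ (1 / 2 - 1 / q.toReal) := by
    rw [Measure.restrict_apply_univ] at h1
    have h3 := h1.trans (mul_le_mul_left (eLpNorm_mono_measure f Measure.restrict_le_self) _)
    have he : 0 ≤ 1 / (2 : ℝ≥0∞).toReal - 1 / q.toReal := by
      rcases eq_or_ne q ⊤ with rfl | hqt
      · simp
      · have : (2 : ℝ) ≤ q.toReal := by
          simpa using ENNReal.toReal_mono hqt hq
        rw [ENNReal.toReal_ofNat, sub_nonneg]
        exact one_div_le_one_div_of_le (by norm_num) this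
    have h4 := ENNReal.toReal_mono (ENNReal.mul_ne_top hf.eLpNorm_ne_top
      (ENNReal.rpow_ne_top_of_nonneg he hs)) h3
    rw [ENNReal.toReal_mul, ← ENNReal.toReal_rpow, toReal_eLpNorm hf.1,
      toReal_eLpNorm hf.1.restrict] at h4
    simpa [Measure.real] using h4
  have h5 : ∫ x in s, f x ^ 2 ∂μ = lpNorm f 2 (μ.restrict s) ^ 2 := by
    rw [lpNorm_two_sq (hf2.restrict s)]; simp
  rw [h5]
  calc _ ≤ (lpNorm f q μ * μ.real s ^ (1 / 2 - 1 / q.toReal)) ^ 2 := by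
        gcongr; exact lpNorm_nonneg
    _ = _ := by
      rw [mul_pow, ← Real.rpow_natCast (_ ^ _), ← Real.rpow_mul measureReal_nonneg, mul_comm]
      congr 2
      push_cast; ring

/-- The ball integral, as a function of the centre, is the convolution of `f` with the indicator of
a ball. It serves to sum local inequalities over all centres without a covering argument. -/
lemma integrable_and_integral_setIntegral_closedBall {N : ℕ} {f : Euc N → ℝ}
    (hf : Integrable f volume) (r : ℝ) :
    Integrable (fun y => ∫ x in Metric.closedBall y r, f x) volume ∧
    ∫ y, ∫ x in Metric.closedBall y r, f x
      = volume.real (Metric.closedBall (0 : Euc N) r) * ∫ x, f x := by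
  set g : Euc N → ℝ := (Metric.closedBall (0 : Euc N) r).indicator fun _ => 1 with hg
  have hgi : Integrable g volume :=
    (integrable_indicator_iff measurableSet_closedBall).2
      (integrableOn_const measure_closedBall_lt_top.ne)
  have hgint : ∫ x, g x = volume.real (Metric.closedBall (0 : Euc N) r) := by
    rw [hg, integral_indicator measurableSet_closedBall]; simp
  have key : (fun y => ∫ x in Metric.closedBall y r, f x)
      = convolution f g (ContinuousLinearMap.mul ℝ ℝ) volume := by
    funext y
    rw [convolution, ← integral_indicator measurableSet_closedBall]
    congr 1 with x
    by_cases hx : x ∈ Metric.closedBall y r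
    · have : y - x ∈ Metric.closedBall (0 : Euc N) r := by
        rw [mem_closedBall_zero_iff, ← dist_eq_norm, dist_comm]; exact hx
      simp [hx, hg, Set.indicator_of_mem this]
    · have : y - x ∉ Metric.closedBall (0 : Euc N) r := by
        rw [mem_closedBall_zero_iff, ← dist_eq_norm, dist_comm]; exact hx
      simp [hx, hg, Set.indicator_of_notMem this]
  refine ⟨key ▸ hf.integrable_convolution _ hgi, ?_⟩
  rw [key, integral_convolution _ hf hgi, hgint, ContinuousLinearMap.mul_apply', mul_comm]

lemma gradient_comp_sub {N : ℕ} (f : Euc N → ℝ) (y x : Euc N) :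
    gradient (fun z => f (z - y)) x = gradient f (x - y) := by
  rw [gradient, gradient, fderiv_comp_sub]

section

variable {N : ℕ} {L S : ℝ} {U : Set (Euc N)} {φ θ : Euc N → ℝ} {q : ℝ≥0∞} {c : ℝ}

lemma volume_real_closedBall_eq (y : Euc N) (r : ℝ) :
    volume.real (Metric.closedBall y r) = volume.real (Metric.closedBall (0 : Euc N) r) := by
  rw [Measure.real, Measure.addHaar_closedBall_center]; rfl

/-- Cut `φ` off around `y` by the cosine of the translated angle, apply Poincaré–Sobolev to the
product, and pass from `L^q` to `L²` by Hölder on the ball of radius `2 * S`. -/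
lemma IsCutoffAngle.setIntegral_sq_le (h : IsCutoffAngle L S θ) (hS : 0 < S) (hq : 2 ≤ q)
    (hc : 0 ≤ c) (hcU : ENNReal.ofReal c ≤ poincareSobolev 2 q U) (hφ : IsTestFunction U φ)
    (y : Euc N) :
    c * ∫ x in Metric.closedBall y S, φ x ^ 2
      ≤ volume.real (Metric.closedBall (0 : Euc N) (2 * S)) ^ (1 - 2 / q.toReal) *
        ∫ x in Metric.closedBall y (2 * S), (‖gradient φ x‖ ^ 2 + (L / S) ^ 2 * φ x ^ 2) := by
  have hτ : ContDiff ℝ ∞ fun x => θ (x - y) := h.contDiff.comp (contDiff_id.sub contDiff_const)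
  have hψ := hφ.cos_mul hτ
  set ψ : Euc N → ℝ := fun x => Real.cos (θ (x - y)) * φ x with hψdef
  have e1 : ∫ x in Metric.closedBall y S, φ x ^ 2 = ∫ x in Metric.closedBall y S, ψ x ^ 2 := by
    refine setIntegral_congr_fun measurableSet_closedBall fun x hx => ?_
    have : θ (x - y) = 0 := h.eq_zero _ (by rw [← dist_eq_norm]; exact hx)
    simp [hψdef, this]
  have e2 : ∫ x in Metric.closedBall y S, ψ x ^ 2
      ≤ ∫ x in Metric.closedBall y (2 * S), ψ x ^ 2 :=
    setIntegral_mono_set hψ.integrable_sq.integrableOn (.of_forall fun _ => sq_nonneg _)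
      (Metric.closedBall_subset_closedBall (by linarith)).eventuallyLE
  have e3 := setIntegral_sq_le_lpNorm hq (hψ.memLp 2) (hψ.memLp q)
    (measure_closedBall_lt_top (x := y) (r := 2 * S)).ne
  rw [volume_real_closedBall_eq] at e3
  have e4 := hψ.mul_lpNorm_sq_le hcU
  have hint : Integrable (fun x => ‖gradient φ x‖ ^ 2 + (L / S) ^ 2 * φ x ^ 2) volume :=
    hφ.integrable_gradient_sq.add (hφ.integrable_sq.const_mul _)
  have e5 : lpNorm (gradient ψ) 2 volume ^ 2
      ≤ ∫ x in Metric.closedBall y (2 * S), (‖gradient φ x‖ ^ 2 + (L / S) ^ 2 * φ x ^ 2) := by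
    rw [hψ.lpNorm_gradient_sq, ← integral_indicator measurableSet_closedBall]
    refine integral_mono hψ.integrable_gradient_sq (hint.indicator measurableSet_closedBall)
      fun x => ?_
    simp only []
    by_cases hx : x ∈ Metric.closedBall y (2 * S)
    · rw [Set.indicator_of_mem hx]
      have h1 := norm_gradient_cos_mul_sq_add_sin hφ.contDiff hτ x
      have h2 := sq_nonneg ‖gradient (fun z => Real.sin (θ (z - y)) * φ z) x‖
      have h3 : ‖gradient (fun z => θ (z - y)) x‖ ^ 2 ≤ (L / S) ^ 2 := by
        rw [gradient_comp_sub]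
        gcongr
        exact h.norm_gradient_le _
      nlinarith [sq_nonneg (φ x)]
    · rw [Set.indicator_of_notMem hx]
      have hx' : 2 * S < ‖x - y‖ := by
        rw [← dist_eq_norm]; simpa using hx
      rw [gradient_cos_mul hφ.contDiff hτ, gradient_comp_sub, h.gradient_eq_zero hx',
        h.cos_eq_zero hx'.le]
      simp
  set V := volume.real (Metric.closedBall (0 : Euc N) (2 * S)) ^ (1 - 2 / q.toReal)
  have hV : 0 ≤ V := Real.rpow_nonneg measureReal_nonneg _
  calc c * ∫ x in Metric.closedBall y S, φ x ^ 2 ≤ c * (V * lpNorm ψ q volume ^ 2) := by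
        gcongr; linarith
    _ = V * (c * lpNorm ψ q volume ^ 2) := by ring
    _ ≤ _ := by gcongr; linarith

/-- Integrate the local estimate over `y`. Both sides become global integrals times ball volumes,
and `2 ^ N` is the ratio of these volumes. -/
lemma IsCutoffAngle.mul_lpNorm_sq_le (h : IsCutoffAngle L S θ) (hS : 0 < S) (hq : 2 ≤ q)
    (hc : 0 ≤ c) (hcU : ENNReal.ofReal c ≤ poincareSobolev 2 q U) (hφ : IsTestFunction U φ) :
    c * lpNorm φ 2 volume ^ 2
      ≤ 2 ^ N * volume.real (Metric.closedBall (0 : Euc N) (2 * S)) ^ (1 - 2 / q.toReal) *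
        (lpNorm (gradient φ) 2 volume ^ 2 + (L / S) ^ 2 * lpNorm φ 2 volume ^ 2) := by
  have hint : Integrable (fun x => ‖gradient φ x‖ ^ 2 + (L / S) ^ 2 * φ x ^ 2) volume :=
    hφ.integrable_gradient_sq.add (hφ.integrable_sq.const_mul _)
  obtain ⟨a1, a2⟩ := integrable_and_integral_setIntegral_closedBall hφ.integrable_sq S
  obtain ⟨b1, b2⟩ := integrable_and_integral_setIntegral_closedBall hint (2 * S)
  have h1 := integral_mono (a1.const_mul c)
    (b1.const_mul (volume.real (Metric.closedBall (0 : Euc N) (2 * S)) ^ (1 - 2 / q.toReal)))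
    fun y => h.setIntegral_sq_le hS hq hc hcU hφ y
  rw [integral_const_mul, integral_const_mul, a2, b2,
    integral_add hφ.integrable_gradient_sq (hφ.integrable_sq.const_mul _), integral_const_mul,
    ← hφ.lpNorm_gradient_sq, ← hφ.lpNorm_sq] at h1
  have h2 : volume.real (Metric.closedBall (0 : Euc N) (2 * S))
      = 2 ^ N * volume.real (Metric.closedBall (0 : Euc N) S) := by
    rw [Measure.real, Measure.real, Measure.addHaar_closedBall_mul _ _ (by norm_num) hS.le,
      ENNReal.toReal_mul, ENNReal.toReal_ofReal (by positivity)]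
    simp
  have h3 : 0 < volume.real (Metric.closedBall (0 : Euc N) S) :=
    ENNReal.toReal_pos (Metric.measure_closedBall_pos _ _ hS).ne' measure_closedBall_lt_top.ne
  set V := volume.real (Metric.closedBall (0 : Euc N) (2 * S)) ^ (1 - 2 / q.toReal)
  rw [h2] at h1
  refine le_of_mul_le_mul_left ?_ h3
  linarith

/-- For a subcritical exponent, the Poincaré–Sobolev inequality implies the Poincaré inequality. -/
lemma exists_lpNorm_two_sq_le (hq : 2 ≤ q) (hsub : N * (1 - 2 / q.toReal) < 2)
    (hc : 0 < c) (hcU : ENNReal.ofReal c ≤ poincareSobolev 2 q U) :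
    ∃ C : ℝ, 0 < C ∧ ∀ φ, IsTestFunction U φ →
      lpNorm φ 2 volume ^ 2 ≤ C * lpNorm (gradient φ) 2 volume ^ 2 := by
  obtain ⟨L, hL, hcut⟩ := exists_isCutoffAngle N
  set e := 1 - 2 / q.toReal with he
  set v := volume.real (Metric.closedBall (0 : Euc N) 2) with hv
  have hvol : ∀ S : ℝ, 0 < S →
      volume.real (Metric.closedBall (0 : Euc N) (2 * S)) = S ^ N * v := by
    intro S hS
    rw [hv, Measure.real, Measure.real, mul_comm 2 S,
      Measure.addHaar_closedBall_mul _ _ hS.le (by norm_num),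
      ENNReal.toReal_mul, ENNReal.toReal_ofReal (by positivity)]
    simp
  have hv0 : 0 ≤ v := measureReal_nonneg
  -- The function is the coefficient of the `L²` term on the right of the averaged estimate.
  -- Subcriticality makes its power of `S` negative, so for large `S` the term is absorbed into half
  -- of the left side.
  have hlim : Tendsto (fun S : ℝ => 2 ^ N * v ^ e * L ^ 2 * S ^ (-(2 - N * e))) atTop (𝓝 0) := by
    simpa using (tendsto_rpow_neg_atTop (by linarith : 0 < 2 - N * e)).const_mul
      (2 ^ N * v ^ e * L ^ 2)
  obtain ⟨S, hS1, hS⟩ := ((hlim.eventually (gt_mem_nhds (by positivity : 0 < c / 2))).and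
    (eventually_gt_atTop 0)).exists
  obtain ⟨θ, hθ⟩ := hcut S hS
  set W := 2 ^ N * volume.real (Metric.closedBall (0 : Euc N) (2 * S)) ^ e with hW
  have hW0 : 0 ≤ W := mul_nonneg (by positivity) (Real.rpow_nonneg measureReal_nonneg _)
  have hWS : W * (L / S) ^ 2 < c / 2 := by
    refine lt_of_eq_of_lt ?_ hS1
    rw [hW, hvol S hS, Real.mul_rpow (by positivity) hv0, ← Real.rpow_natCast S N,
      ← Real.rpow_mul hS.le, neg_sub, Real.rpow_sub hS, Real.rpow_two]
    ring
  refine ⟨2 * W / c + 1, by positivity, fun φ hφ => ?_⟩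
  have h1 := hθ.mul_lpNorm_sq_le hS hq hc.le hcU hφ
  rw [← he, ← hW] at h1
  have h2 : c / 2 * lpNorm φ 2 volume ^ 2 ≤ W * lpNorm (gradient φ) 2 volume ^ 2 := by
    nlinarith [sq_nonneg (lpNorm φ 2 volume)]
  have h3 : lpNorm φ 2 volume ^ 2 ≤ 2 * W / c * lpNorm (gradient φ) 2 volume ^ 2 := by
    rw [div_mul_eq_mul_div, le_div_iff₀ hc]; linarith
  nlinarith [sq_nonneg (lpNorm (gradient φ) 2 volume)]

/-- A Poincaré inequality outside a ball implies a Poincaré inequality on the whole set, up to a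
lower order term. -/
lemma exists_lpNorm_two_sq_le_add (hq : 2 ≤ q) (hsub : N * (1 - 2 / q.toReal) < 2)
    (hc : 0 < c) {R : ℝ} (hR : 0 < R)
    (hcU : ENNReal.ofReal c ≤ poincareSobolev 2 q (U \ Metric.closedBall 0 R)) :
    ∃ C : ℝ, 0 < C ∧ ∀ φ, IsTestFunction U φ →
      lpNorm φ 2 volume ^ 2
        ≤ C * (lpNorm (gradient φ) 2 volume ^ 2 + lpNorm φ q volume ^ 2) := by
  obtain ⟨C, hC, hP⟩ := exists_lpNorm_two_sq_le hq hsub hc hcU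
  obtain ⟨L, hL, hcut⟩ := exists_isCutoffAngle N
  -- Any scale above `R` would do. The sine piece then lives outside the ball, where Poincaré holds,
  -- and the cosine piece is controlled by Hölder on a bounded set.
  obtain ⟨θ, hθ⟩ := hcut (R + 1) (by linarith)
  set B := Metric.closedBall (0 : Euc N) (2 * (R + 1)) with hB
  set V := volume.real B ^ (1 - 2 / q.toReal)
  have hV : 0 ≤ V := Real.rpow_nonneg measureReal_nonneg _
  set κ := (L / (R + 1)) ^ 2 with hκ
  have hκ0 : 0 ≤ κ := sq_nonneg _
  refine ⟨C + V + C * κ * V, by positivity, fun φ hφ => ?_⟩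
  have h1 := setIntegral_sq_le_lpNorm hq (hφ.memLp 2) (hφ.memLp q)
    (measure_closedBall_lt_top (x := (0 : Euc N)) (r := 2 * (R + 1))).ne
  rw [← hB] at h1
  have h2 : lpNorm (fun x => Real.cos (θ x) * φ x) 2 volume ^ 2 ≤ ∫ x in B, φ x ^ 2 := by
    rw [(hφ.cos_mul hθ.contDiff).lpNorm_sq, ← integral_indicator measurableSet_closedBall]
    refine integral_mono (hφ.cos_mul hθ.contDiff).integrable_sq
      (hφ.integrable_sq.indicator measurableSet_closedBall) fun x => ?_
    simp only []
    by_cases hx : x ∈ B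
    · rw [Set.indicator_of_mem hx, mul_pow]
      exact mul_le_of_le_one_left (sq_nonneg _) (Real.cos_sq_le_one _)
    · rw [Set.indicator_of_notMem hx, hθ.cos_eq_zero (by simpa [hB] using (not_le.1 (by simpa [hB] using hx)).le)]
      simp
  have h3 := hP _ (hθ.isTestFunction_sin_mul (by linarith) hφ)
  have h4 := hθ.lpNorm_gradient_le hφ
  have h5 := hφ.lpNorm_cos_sq_add_sin hθ.contDiff
  rw [← hB, ← hκ] at h4
  have h6 : lpNorm (gradient fun x => Real.sin (θ x) * φ x) 2 volume ^ 2
      ≤ lpNorm (gradient φ) 2 volume ^ 2 + κ * (V * lpNorm φ q volume ^ 2) := by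
    have := mul_le_mul_of_nonneg_left h1 hκ0
    nlinarith [sq_nonneg (lpNorm (gradient fun x => Real.cos (θ x) * φ x) 2 volume)]
  have h7 := mul_le_mul_of_nonneg_left h6 hC.le
  have h8 : 0 ≤ (V + C * κ * V) * lpNorm (gradient φ) 2 volume ^ 2 := by positivity
  have h9 : 0 ≤ C * lpNorm φ q volume ^ 2 := by positivity
  linarith

/-- The squared `L^q` norm is the `L^(q/2)` norm of the square, and `q / 2 ≥ 1`, so this is the
triangle inequality for `f² = (cos θ f)² + (sin θ f)²`. -/
lemma lpNorm_sq_le_cos_add_sin (hq : 2 ≤ q) {f θ : Euc N → ℝ} (hf : MemLp f q volume)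
    (hc : MemLp (fun x => Real.cos (θ x) * f x) q volume)
    (hs : MemLp (fun x => Real.sin (θ x) * f x) q volume) :
    lpNorm f q volume ^ 2 ≤ lpNorm (fun x => Real.cos (θ x) * f x) q volume ^ 2
      + lpNorm (fun x => Real.sin (θ x) * f x) q volume ^ 2 := by
  have hp : 1 ≤ q / 2 := by
    rw [ENNReal.le_div_iff_mul_le (by simp) (by simp)]; simpa using hq
  have key : ∀ g : Euc N → ℝ, MemLp g q volume →
      MemLp (fun x => ‖g x‖ ^ (2 : ℝ)) (q / 2) volume ∧
      eLpNorm (fun x => ‖g x‖ ^ (2 : ℝ)) (q / 2) volume = ENNReal.ofReal (lpNorm g q volume ^ 2) := by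
    intro g hg
    have h1 : eLpNorm (fun x => ‖g x‖ ^ (2 : ℝ)) (q / 2) volume
        = ENNReal.ofReal (lpNorm g q volume ^ 2) := by
      rw [eLpNorm_norm_rpow _ (by norm_num), ENNReal.ofReal_pow lpNorm_nonneg, ofReal_lpNorm hg]
      rw [ENNReal.ofReal_ofNat, ENNReal.div_mul_cancel (by simp) (by simp)]
      norm_cast
    refine ⟨⟨?_, by rw [h1]; simp⟩, h1⟩
    exact (hg.1.norm.aemeasurable.pow_const _).aestronglyMeasurable
  have h1 : (fun x => ‖f x‖ ^ (2 : ℝ)) = (fun x => ‖Real.cos (θ x) * f x‖ ^ (2 : ℝ))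
      + fun x => ‖Real.sin (θ x) * f x‖ ^ (2 : ℝ) := by
    funext x
    simp only [Pi.add_apply, Real.rpow_two, Real.norm_eq_abs, sq_abs]
    linear_combination - f x ^ 2 * Real.sin_sq_add_cos_sq (θ x)
  have h2 := eLpNorm_add_le (key _ hc).1.1 (key _ hs).1.1 hp
  rw [← h1, (key _ hf).2, (key _ hc).2, (key _ hs).2, ← ENNReal.ofReal_add (by positivity)
    (by positivity), ENNReal.ofReal_le_ofReal_iff (by positivity)] at h2
  exact h2

/-- Almost minimizers carry little mass at infinity. -/
lemma IsCutoffAngle.mul_lpNorm_sin_sq_le (h : IsCutoffAngle L S θ) (hq : 2 ≤ q) {l R : ℝ}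
    (hl : 0 ≤ l) (hRS : R < S) (hlU : ENNReal.ofReal l ≤ poincareSobolev 2 q U)
    (hcU : ENNReal.ofReal c ≤ poincareSobolev 2 q (U \ Metric.closedBall 0 R))
    (hφ : IsTestFunction U φ) (h1 : lpNorm φ q volume = 1) :
    (c - l) * lpNorm (fun x => Real.sin (θ x) * φ x) q volume ^ 2
      ≤ lpNorm (gradient φ) 2 volume ^ 2 - l + (L / S) ^ 2 * lpNorm φ 2 volume ^ 2 := by
  have hcos := hφ.cos_mul h.contDiff
  have hsin := h.isTestFunction_sin_mul hRS hφ
  have e1 := lpNorm_sq_le_cos_add_sin (θ := θ) hq (hφ.memLp q) (hcos.memLp q) (hsin.memLp q)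
  have e2 := hcos.mul_lpNorm_sq_le hlU
  have e3 := hsin.mul_lpNorm_sq_le hcU
  have e4 := h.lpNorm_gradient_le hφ
  have e5 : ∫ x in Metric.closedBall 0 (2 * S), φ x ^ 2 ≤ lpNorm φ 2 volume ^ 2 := by
    rw [hφ.lpNorm_sq]
    exact setIntegral_le_integral hφ.integrable_sq (.of_forall fun _ => sq_nonneg _)
  have e6 := mul_le_mul_of_nonneg_left e5 (sq_nonneg (L / S))
  -- The pieces cost at least `l` and `c` times their squared norms. As these sum to at least 1, the
  -- total is at least `l` plus `c - l` times the sine piece.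
  rw [h1] at e1
  nlinarith

end

/-! ### Translations, ball averages and Rellich's theorem -/

lemma sq_integral_le {α : Type*} [MeasurableSpace α] {μ : Measure α} [IsProbabilityMeasure μ]
    {f : α → ℝ} (hf : MemLp f 2 μ) : (∫ x, f x ∂μ) ^ 2 ≤ ∫ x, f x ^ 2 ∂μ := by
  have h1 := ProbabilityTheory.variance_nonneg f μ
  rw [ProbabilityTheory.variance_eq_sub hf] at h1
  simpa using h1

lemma ofReal_sq_integral_le {α : Type*} [MeasurableSpace α] {μ : Measure α}
    [IsProbabilityMeasure μ] {f : α → ℝ} (hf : MemLp f 2 μ) :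
    ENNReal.ofReal ((∫ x, f x ∂μ) ^ 2) ≤ ∫⁻ x, ENNReal.ofReal (f x ^ 2) ∂μ := by
  rw [← ofReal_integral_eq_lintegral_ofReal hf.integrable_sq (.of_forall fun _ => sq_nonneg _)]
  exact ENNReal.ofReal_le_ofReal (sq_integral_le hf)

section Translation

variable {N : ℕ} {U : Set (Euc N)} {φ : Euc N → ℝ}

lemma IsTestFunction.ofReal_lpNorm_gradient_sq (h : IsTestFunction U φ) :
    ENNReal.ofReal (lpNorm (gradient φ) 2 volume ^ 2)
      = ∫⁻ x, ENNReal.ofReal (‖gradient φ x‖ ^ 2) := by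
  rw [h.lpNorm_gradient_sq, ofReal_integral_eq_lintegral_ofReal h.integrable_gradient_sq
    (.of_forall fun _ => sq_nonneg _)]

lemma IsTestFunction.exists_bound (h : IsTestFunction U φ) : ∃ C, ∀ x, ‖φ x‖ ≤ C :=
  h.2.1.exists_bound_of_continuous h.1.continuous

/-- The fundamental theorem of calculus on the segment from `x` to `x + v`, followed by Jensen. The
extended nonnegative form allows Tonelli afterwards without integrability checks. -/
lemma IsTestFunction.ofReal_sq_sub_le (h : IsTestFunction U φ) (x v : Euc N) :
    ENNReal.ofReal ((φ (x + v) - φ x) ^ 2)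
      ≤ ∫⁻ t in Set.Icc (0 : ℝ) 1, ENNReal.ofReal (‖v‖ ^ 2 * ‖gradient φ (x + t • v)‖ ^ 2) := by
  have hprob : IsProbabilityMeasure (volume.restrict (Set.Icc (0 : ℝ) 1)) := ⟨by simp⟩
  have hcont : Continuous fun t : ℝ => inner ℝ (gradient φ (x + t • v)) v := by
    have := h.1.continuous_gradient
    fun_prop
  have hder : ∀ t : ℝ, HasDerivAt (fun t : ℝ => φ (x + t • v))
      (inner ℝ (gradient φ (x + t • v)) v) t := by
    intro t
    have h1 : HasDerivAt (fun t : ℝ => x + t • v) v t := by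
      simpa using ((hasDerivAt_id t).smul_const v).const_add x
    exact (hasGradientAt_iff_hasFDerivAt.1 (h.1.hasGradientAt (x + t • v))).comp_hasDerivAt t h1
  have hftc : φ (x + v) - φ x
      = ∫ t in Set.Icc (0 : ℝ) 1, inner ℝ (gradient φ (x + t • v)) v := by
    rw [integral_Icc_eq_integral_Ioc, ← intervalIntegral.integral_of_le zero_le_one,
      intervalIntegral.integral_eq_sub_of_hasDerivAt (fun t _ => hder t)
        (hcont.intervalIntegrable _ _)]
    simp
  have hmem : MemLp (fun t : ℝ => inner ℝ (gradient φ (x + t • v)) v) 2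
      (volume.restrict (Set.Icc (0 : ℝ) 1)) := by
    obtain ⟨C, hC⟩ := isCompact_Icc.exists_bound_of_continuousOn hcont.continuousOn
    exact MemLp.of_bound hcont.aestronglyMeasurable C
      ((ae_restrict_iff' measurableSet_Icc).2 (.of_forall hC))
  rw [hftc]
  refine (ofReal_sq_integral_le hmem).trans (lintegral_mono fun t => ENNReal.ofReal_le_ofReal ?_)
  rw [← mul_pow, mul_comm, sq_le_sq, abs_of_nonneg (a := _ * _) (by positivity)]
  exact abs_real_inner_le_norm _ _

lemma IsTestFunction.lintegral_sq_sub_le (h : IsTestFunction U φ) (v : Euc N) :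
    ∫⁻ x, ENNReal.ofReal ((φ (x + v) - φ x) ^ 2)
      ≤ ENNReal.ofReal (‖v‖ ^ 2 * lpNorm (gradient φ) 2 volume ^ 2) := by
  have hgc := h.1.continuous_gradient
  refine (lintegral_mono fun x => h.ofReal_sq_sub_le x v).trans ?_
  rw [lintegral_lintegral_swap (by fun_prop)]
  have h1 : ∀ t : ℝ, ∫⁻ x, ENNReal.ofReal (‖v‖ ^ 2 * ‖gradient φ (x + t • v)‖ ^ 2)
      = ENNReal.ofReal (‖v‖ ^ 2 * lpNorm (gradient φ) 2 volume ^ 2) := by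
    intro t
    rw [lintegral_add_right_eq_self
      (fun x => ENNReal.ofReal (‖v‖ ^ 2 * ‖gradient φ x‖ ^ 2)) (t • v),
      ENNReal.ofReal_mul (by positivity), h.ofReal_lpNorm_gradient_sq,
      ← lintegral_const_mul _ (by fun_prop)]
    simp_rw [ENNReal.ofReal_mul (sq_nonneg ‖v‖)]
  simp_rw [h1]
  simp

end Translation

/-- The uniform probability measure on the ball of radius `ε` centred at the origin. -/
noncomputable abbrev uniformBall (N : ℕ) (ε : ℝ) : Measure (Euc N) :=
  ProbabilityTheory.cond volume (Metric.ball 0 ε)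

lemma isProbabilityMeasure_uniformBall (N : ℕ) {ε : ℝ} (hε : 0 < ε) :
    IsProbabilityMeasure (uniformBall N ε) :=
  ProbabilityTheory.cond_isProbabilityMeasure_of_finite
    (Metric.measure_ball_pos _ _ hε).ne' measure_ball_lt_top.ne

/-- The average of `f` over the ball of radius `ε` centred at `x`. -/
noncomputable def ballAverage {N : ℕ} (ε : ℝ) (f : Euc N → ℝ) (x : Euc N) : ℝ :=
  ∫ h, f (x + h) ∂(uniformBall N ε)

section Average

variable {N : ℕ} {U : Set (Euc N)} {φ ψ : Euc N → ℝ} {ε : ℝ}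

lemma integral_uniformBall (f : Euc N → ℝ) (ε : ℝ) : ∫ h, f h ∂(uniformBall N ε)
    = (volume.real (Metric.ball (0 : Euc N) ε))⁻¹ * ∫ h in Metric.ball 0 ε, f h := by
  rw [uniformBall, ProbabilityTheory.cond, integral_smul_measure, smul_eq_mul, ENNReal.toReal_inv]
  rfl

lemma ballAverage_eq (f : Euc N → ℝ) (ε : ℝ) (x : Euc N) : ballAverage ε f x
    = (volume.real (Metric.ball (0 : Euc N) ε))⁻¹ * ∫ y in Metric.ball x ε, f y := by
  rw [ballAverage, integral_uniformBall (fun h => f (x + h)), ← integral_indicator measurableSet_ball,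
    ← integral_indicator measurableSet_ball,
    ← integral_add_left_eq_self ((Metric.ball x ε).indicator f) x]
  congr 2
  funext h
  by_cases hh : h ∈ Metric.ball (0 : Euc N) ε
  · have : x + h ∈ Metric.ball x ε := by simpa using hh
    simp only [Set.indicator_of_mem hh, Set.indicator_of_mem this]
  · have : x + h ∉ Metric.ball x ε := by simpa using hh
    simp only [Set.indicator_of_notMem hh, Set.indicator_of_notMem this]

lemma IsTestFunction.memLp_translate (h : IsTestFunction U φ) (hε : 0 < ε) (x : Euc N)
    (p : ℝ≥0∞) : MemLp (fun v => φ (x + v)) p (uniformBall N ε) := by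
  have := isProbabilityMeasure_uniformBall N hε
  obtain ⟨C, hC⟩ := h.exists_bound
  have := h.1.continuous
  exact MemLp.of_bound (Continuous.aestronglyMeasurable (by fun_prop)) C (.of_forall fun v => hC _)

lemma IsTestFunction.ballAverage_sub (h : IsTestFunction U φ) (h' : IsTestFunction U ψ)
    (hε : 0 < ε) (x : Euc N) : ballAverage ε (fun y => φ y - ψ y) x
      = ballAverage ε φ x - ballAverage ε ψ x := by
  have := isProbabilityMeasure_uniformBall N hε
  exact integral_sub ((h.memLp_translate hε x 1).integrable le_rfl)
    ((h'.memLp_translate hε x 1).integrable le_rfl)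

lemma IsTestFunction.continuous_ballAverage (h : IsTestFunction U φ) (hε : 0 < ε) :
    Continuous (ballAverage ε φ) := by
  have := isProbabilityMeasure_uniformBall N hε
  obtain ⟨C, hC⟩ := h.exists_bound
  have := h.1.continuous
  refine continuous_of_dominated (bound := fun _ => C)
    (fun x => (Continuous.aestronglyMeasurable (by fun_prop)))
    (fun x => .of_forall fun v => hC _) (integrable_const C) (.of_forall fun v => by fun_prop)

/-- By Jensen. The bound is uniform in `x`, and supplies the dominating constant in Rellich's
theorem. -/
lemma IsTestFunction.ballAverage_sq_le (h : IsTestFunction U φ) (hε : 0 < ε) (x : Euc N) :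
    ballAverage ε φ x ^ 2
      ≤ (volume.real (Metric.ball (0 : Euc N) ε))⁻¹ * lpNorm φ 2 volume ^ 2 := by
  have := isProbabilityMeasure_uniformBall N hε
  refine (sq_integral_le (h.memLp_translate hε x 2)).trans ?_
  have := ballAverage_eq (fun y => φ y ^ 2) ε x
  rw [ballAverage] at this
  rw [this, h.lpNorm_sq]
  refine mul_le_mul_of_nonneg_left ?_ (by positivity)
  exact setIntegral_le_integral h.integrable_sq (.of_forall fun _ => sq_nonneg _)

/-- A function is approximated in `L²` by its averages, at a rate given by its gradient. -/
lemma IsTestFunction.lintegral_sub_ballAverage_sq_le (h : IsTestFunction U φ) (hε : 0 < ε) :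
    ∫⁻ x, ENNReal.ofReal ((ballAverage ε φ x - φ x) ^ 2)
      ≤ ENNReal.ofReal (ε ^ 2 * lpNorm (gradient φ) 2 volume ^ 2) := by
  have := isProbabilityMeasure_uniformBall N hε
  have hφc := h.1.continuous
  have h1 : ∀ x, ENNReal.ofReal ((ballAverage ε φ x - φ x) ^ 2)
      ≤ ∫⁻ v, ENNReal.ofReal ((φ (x + v) - φ x) ^ 2) ∂(uniformBall N ε) := by
    intro x
    have e1 : ballAverage ε φ x - φ x = ∫ v, (φ (x + v) - φ x) ∂(uniformBall N ε) := by
      rw [integral_sub ((h.memLp_translate hε x 1).integrable le_rfl) (integrable_const _)]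
      simp [ballAverage]
    rw [e1]
    exact ofReal_sq_integral_le ((h.memLp_translate hε x 2).sub (memLp_const _))
  refine (lintegral_mono h1).trans ?_
  rw [lintegral_lintegral_swap (by fun_prop)]
  have h2 : ∀ᵐ v ∂(uniformBall N ε), ∫⁻ x, ENNReal.ofReal ((φ (x + v) - φ x) ^ 2)
      ≤ ENNReal.ofReal (ε ^ 2 * lpNorm (gradient φ) 2 volume ^ 2) := by
    filter_upwards [ProbabilityTheory.ae_cond_mem measurableSet_ball] with v hv
    refine (h.lintegral_sq_sub_le v).trans (ENNReal.ofReal_le_ofReal ?_)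
    gcongr
    exact (mem_ball_zero_iff.1 hv).le
  refine (lintegral_mono_ae h2).trans ?_
  simp

/-- Compare `φ` with its average. The gradient pays for the difference, and what remains is an
average, for which weak convergence suffices. -/
lemma IsTestFunction.setIntegral_sq_le (h : IsTestFunction U φ) (hε : 0 < ε) {s : Set (Euc N)}
    (hs : volume s ≠ ⊤) :
    ∫ x in s, φ x ^ 2 ≤ 2 * (ε ^ 2 * lpNorm (gradient φ) 2 volume ^ 2)
      + 2 * ∫ x in s, ballAverage ε φ x ^ 2 := by
  have hA := h.continuous_ballAverage hε
  have hφc := h.1.continuous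
  have i1 : Integrable (fun x => (ballAverage ε φ x - φ x) ^ 2) volume := by
    refine ⟨Continuous.aestronglyMeasurable (by fun_prop), ?_⟩
    rw [hasFiniteIntegral_iff_ofReal (.of_forall fun _ => sq_nonneg _)]
    exact (h.lintegral_sub_ballAverage_sq_le hε).trans_lt ENNReal.ofReal_lt_top
  have i2 : ∫ x, (ballAverage ε φ x - φ x) ^ 2 ≤ ε ^ 2 * lpNorm (gradient φ) 2 volume ^ 2 := by
    rw [← ENNReal.ofReal_le_ofReal_iff (by positivity),
      ofReal_integral_eq_lintegral_ofReal i1 (.of_forall fun _ => sq_nonneg _)]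
    exact h.lintegral_sub_ballAverage_sq_le hε
  have i3 : IntegrableOn (fun x => ballAverage ε φ x ^ 2) s volume := by
    refine Measure.integrableOn_of_bounded hs (Continuous.aestronglyMeasurable (by fun_prop))
      (M := (volume.real (Metric.ball (0 : Euc N) ε))⁻¹ * lpNorm φ 2 volume ^ 2)
      (.of_forall fun x => ?_)
    rw [Real.norm_of_nonneg (sq_nonneg _)]
    exact h.ballAverage_sq_le hε x
  have i4 : ∫ x in s, (ballAverage ε φ x - φ x) ^ 2 ≤ ∫ x, (ballAverage ε φ x - φ x) ^ 2 :=
    setIntegral_le_integral i1 (.of_forall fun _ => sq_nonneg _)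
  calc ∫ x in s, φ x ^ 2 ≤ ∫ x in s, (2 * (ballAverage ε φ x - φ x) ^ 2
        + 2 * ballAverage ε φ x ^ 2) := by
        refine integral_mono h.integrable_sq.integrableOn
          ((i1.integrableOn.const_mul 2).add (i3.const_mul 2)) fun x => ?_
        simp only []
        nlinarith [sq_nonneg (2 * ballAverage ε φ x - φ x)]
    _ = 2 * (∫ x in s, (ballAverage ε φ x - φ x) ^ 2) + 2 * ∫ x in s, ballAverage ε φ x ^ 2 := by
        rw [integral_add (i1.integrableOn.const_mul 2) (i3.const_mul 2), integral_const_mul,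
          integral_const_mul]
    _ ≤ _ := by linarith

end Average

/-- A bounded sequence in `L²` has a weakly convergent subsequence. -/
lemma exists_subseq_tendsto_setIntegral {α : Type*} [MeasurableSpace α] {μ : Measure α}
    [IsSeparable μ] {f : ℕ → α → ℝ} (hf : ∀ n, MemLp (f n) 2 μ) {M : ℝ}
    (hM : ∀ n, lpNorm (f n) 2 μ ≤ M) :
    ∃ k : ℕ → ℕ, StrictMono k ∧ ∀ s : Set α, MeasurableSet s → μ s ≠ ⊤ →
      ∃ a : ℝ, Tendsto (fun n => ∫ x in s, f (k n) x ∂μ) atTop (𝓝 a) := by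
  have : Fact ((2 : ℝ≥0∞) ≠ ⊤) := ⟨by simp⟩
  -- Riesz places the sequence in a ball of the dual, which is weak-* sequentially compact because
  -- `L²` is separable here. Testing against indicators then gives convergence of set integrals.
  let F : ℕ → WeakDual ℝ (Lp ℝ 2 μ) := fun n =>
    StrongDual.toWeakDual (InnerProductSpace.toDual ℝ (Lp ℝ 2 μ) ((hf n).toLp (f n)))
  obtain ⟨G, -, k, hk, hG⟩ := WeakDual.isSeqCompact_closedBall ℝ (Lp ℝ 2 μ) 0 M (x := F) (by
    intro n
    rw [Set.mem_preimage, mem_closedBall_zero_iff]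
    refine (LinearIsometryEquiv.norm_map (InnerProductSpace.toDual ℝ (Lp ℝ 2 μ)) _).trans_le ?_
    rw [Lp.norm_toLp, toReal_eLpNorm (hf n).1]
    exact hM n)
  refine ⟨k, hk, fun s hs hμs => ⟨G (indicatorConstLp 2 hs hμs 1), ?_⟩⟩
  have h1 := ((WeakDual.eval_continuous (𝕜 := ℝ) (indicatorConstLp 2 hs hμs (1 : ℝ))).tendsto G).comp hG
  refine h1.congr fun n => ?_
  have h2 : (F (k n)) (indicatorConstLp 2 hs hμs (1 : ℝ))
      = inner ℝ ((hf (k n)).toLp (f (k n))) (indicatorConstLp 2 hs hμs (1 : ℝ)) := rfl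
  rw [Function.comp_apply, Function.comp_apply, h2, real_inner_comm, L2.inner_indicatorConstLp_one]
  exact setIntegral_congr_ae hs ((hf (k n)).coeFn_toLp.mono fun x hx _ => hx)

/-- **Rellich's theorem**: a sequence of test functions which is bounded in `W^{1,2}` has a
subsequence which is Cauchy in `L²` of every ball. -/
lemma exists_subseq_tendsto_setIntegral_sq_sub {N : ℕ} {U : Set (Euc N)} {φ : ℕ → Euc N → ℝ}
    (hφ : ∀ n, IsTestFunction U (φ n)) {M : ℝ} (hM : ∀ n, lpNorm (φ n) 2 volume ≤ M)
    (hM' : ∀ n, lpNorm (gradient (φ n)) 2 volume ≤ M) :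
    ∃ k : ℕ → ℕ, StrictMono k ∧ ∀ r : ℝ, Tendsto
      (fun p : ℕ × ℕ => ∫ x in Metric.closedBall 0 r, (φ (k p.1) x - φ (k p.2) x) ^ 2)
      (atTop ×ˢ atTop) (𝓝 0) := by
  obtain ⟨k, hk, hlim⟩ := exists_subseq_tendsto_setIntegral (fun n => (hφ n).memLp 2) hM
  refine ⟨k, hk, fun r => ?_⟩
  have hM0 : 0 ≤ M := lpNorm_nonneg.trans (hM 0)
  have hsub : ∀ p : ℕ × ℕ, IsTestFunction U (fun x => φ (k p.1) x - φ (k p.2) x) :=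
    fun p => (hφ _).sub (hφ _)
  -- For fixed `ε` the averages converge at every point, since they are set integrals over balls.
  -- Dominated convergence concludes.
  have hA : ∀ ε : ℝ, 0 < ε → Tendsto (fun p : ℕ × ℕ => ∫ x in Metric.closedBall 0 r,
      ballAverage ε (fun x => φ (k p.1) x - φ (k p.2) x) x ^ 2) (atTop ×ˢ atTop) (𝓝 0) := by
    intro ε hε
    set v := (volume.real (Metric.ball (0 : Euc N) ε))⁻¹ with hv
    have hfin : IsFiniteMeasure (volume.restrict (Metric.closedBall (0 : Euc N) r)) :=
      ⟨by simpa using measure_closedBall_lt_top⟩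
    have := tendsto_integral_filter_of_dominated_convergence
      (μ := volume.restrict (Metric.closedBall (0 : Euc N) r))
      (F := fun p : ℕ × ℕ => fun x => ballAverage ε (fun x => φ (k p.1) x - φ (k p.2) x) x ^ 2)
      (f := fun _ => 0) (l := atTop ×ˢ atTop) (fun _ => v * (2 * M) ^ 2) ?_ ?_ ?_ ?_
    · simpa using this
    · exact .of_forall fun p => (((hsub p).continuous_ballAverage hε).pow 2).aestronglyMeasurable
    · refine .of_forall fun p => .of_forall fun x => ?_
      rw [Real.norm_of_nonneg (sq_nonneg _)]
      refine ((hsub p).ballAverage_sq_le hε x).trans ?_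
      refine mul_le_mul_of_nonneg_left (pow_le_pow_left₀ lpNorm_nonneg ?_ 2) (by positivity)
      refine (lpNorm_sub_le ((hφ (k p.1)).memLp 2) (by norm_num)).trans ?_
      linarith [hM (k p.1), hM (k p.2)]
    · exact integrable_const _
    · refine .of_forall fun x => ?_
      obtain ⟨a, ha⟩ := hlim (Metric.ball x ε) measurableSet_ball measure_ball_lt_top.ne
      have h1 : ∀ p : ℕ × ℕ, ballAverage ε (fun x => φ (k p.1) x - φ (k p.2) x) x ^ 2
          = ((v * ∫ x in Metric.ball x ε, φ (k p.1) x)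
            - v * ∫ x in Metric.ball x ε, φ (k p.2) x) ^ 2 := by
        intro p
        rw [(hφ _).ballAverage_sub (hφ _) hε, ballAverage_eq, ballAverage_eq]
      simp_rw [h1]
      have h2 := (((ha.comp tendsto_fst).const_mul v).sub ((ha.comp tendsto_snd).const_mul v)).pow 2
      simpa using h2
  rw [Metric.tendsto_nhds]
  intro δ hδ
  obtain ⟨ε, hε, hεδ⟩ : ∃ ε : ℝ, 0 < ε ∧ 2 * (ε ^ 2 * (2 * M) ^ 2) < δ / 2 := by
    have : Tendsto (fun ε : ℝ => 2 * (ε ^ 2 * (2 * M) ^ 2)) (𝓝[>] 0) (𝓝 0) := by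
      have : Continuous fun ε : ℝ => 2 * (ε ^ 2 * (2 * M) ^ 2) := by fun_prop
      simpa using (this.tendsto 0).mono_left nhdsWithin_le_nhds
    exact ((eventually_mem_nhdsWithin).and (this.eventually (gt_mem_nhds (half_pos hδ)))).exists
  filter_upwards [(hA ε hε).eventually (gt_mem_nhds (by positivity : 0 < δ / 4))] with p hp
  rw [Real.dist_eq, sub_zero, abs_of_nonneg (integral_nonneg fun _ => sq_nonneg _)]
  have h1 := (hsub p).setIntegral_sq_le hε
    (measure_closedBall_lt_top (x := (0 : Euc N)) (r := r)).ne
  have h2 : lpNorm (gradient fun x => φ (k p.1) x - φ (k p.2) x) 2 volume ≤ 2 * M := by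
    rw [(hφ _).gradient_sub (hφ _)]
    refine (lpNorm_sub_le ((hφ (k p.1)).memLp_gradient 2) (by norm_num)).trans ?_
    linarith [hM' (k p.1), hM' (k p.2)]
  have h3 : lpNorm (gradient fun x => φ (k p.1) x - φ (k p.2) x) 2 volume ^ 2 ≤ (2 * M) ^ 2 :=
    pow_le_pow_left₀ lpNorm_nonneg h2 2
  have h4 := mul_le_mul_of_nonneg_left h3 (sq_nonneg ε)
  linarith

/-! ### Local `L^q` compactness -/

/-- The Sobolev inequality on a ball, for an exponent slightly larger than a subcritical one. -/
lemma exists_lpNorm_le_lpNorm_gradient {N : ℕ} (hN : 2 ≤ N) {q : ℝ} (hq : 2 < q)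
    (hsub : N * (1 - 2 / q) < 2) (ρ : ℝ) :
    ∃ r : ℝ, q < r ∧ ∃ C : ℝ, 0 ≤ C ∧ ∀ (U : Set (Euc N)) (w : Euc N → ℝ), IsTestFunction U w →
      Function.support w ⊆ Metric.closedBall 0 ρ →
      lpNorm w (ENNReal.ofReal r) volume ≤ C * lpNorm (gradient w) 2 volume := by
  have hN' : (2 : ℝ) ≤ N := by exact_mod_cast hN
  have hNpos : (0 : ℝ) < N := by linarith
  have hNinv : (N : ℝ)⁻¹ ≤ 1 / 2 := by
    rw [inv_eq_one_div]; exact one_div_le_one_div_of_le (by norm_num) hN'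
  have h1 : (1 : ℝ) / 2 < q⁻¹ + (N : ℝ)⁻¹ := by
    have : N * (1 - 2 / q) = N * (1 - 2 * q⁻¹) := by ring
    rw [this] at hsub
    have h2 : N * (1 / 2 - q⁻¹) < N * (N : ℝ)⁻¹ := by
      rw [mul_inv_cancel₀ hNpos.ne']; linarith
    linarith [lt_of_mul_lt_mul_left h2 hNpos.le]
  -- Here `s = 1 / p` for a gradient exponent `p` in `[1, 2)`, which is below `N` even when `N = 2`.
  -- The upper bound on `s` makes the Sobolev conjugate `r`, with `1 / r = s - 1 / N`, exceed `q`.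
  obtain ⟨s, hs1, hs2⟩ := exists_between (lt_min (by norm_num : (1 : ℝ) / 2 < 1) h1)
  obtain ⟨hs3, hs4⟩ := lt_min_iff.1 hs2
  have hspos : 0 < s := by linarith
  have hd : 0 < s - (N : ℝ)⁻¹ := by linarith
  set r : ℝ := (s - (N : ℝ)⁻¹)⁻¹ with hr
  have hqr : q < r := by
    rw [hr, lt_inv_comm₀ (by linarith) hd]; linarith
  have hr0 : 0 < r := by linarith
  set p : NNReal := ⟨s⁻¹, by positivity⟩ with hp
  have hpc : (p : ℝ) = s⁻¹ := rfl
  set r' : NNReal := ⟨r, hr0.le⟩ with hr'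
  have hr'E : (r' : ℝ≥0∞) = ENNReal.ofReal r := by
    rw [ENNReal.ofReal, Real.toNNReal_of_nonneg hr0.le]; rfl
  have hp1 : 1 ≤ p := by
    rw [← NNReal.coe_le_coe, hpc]; exact (one_le_inv₀ hspos).2 hs3.le
  have hp2 : (p : ℝ) < 2 := by
    rw [hpc, inv_lt_comm₀ hspos (by norm_num)]; linarith
  have hp2' : (p : ℝ≥0∞) ≤ 2 := by
    exact_mod_cast hp2.le
  set B := Metric.closedBall (0 : Euc N) ρ with hB
  set K := eLpNormLESNormFDerivOfLeConst ℝ (volume : Measure (Euc N)) B p r' with hK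
  set e : ℝ := 1 / (p : ℝ) - 1 / 2 with he
  have he0 : 0 ≤ e := by
    rw [he, sub_nonneg]
    exact one_div_le_one_div_of_le (by rw [hpc]; positivity) hp2.le
  refine ⟨r, hqr, K * volume.real B ^ e, mul_nonneg K.2 (Real.rpow_nonneg measureReal_nonneg _), ?_⟩
  intro U w hw hwB
  have hGNS := eLpNorm_le_eLpNorm_fderiv_of_le (volume : Measure (Euc N)) (u := w) (s := B)
    (p := p) (q := r') (hw.1.of_le (by simp)) hwB hp1 (by
      rw [finrank_euclideanSpace_fin, ← NNReal.coe_lt_coe]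
      simp only [NNReal.coe_natCast]; linarith) (by
      rw [finrank_euclideanSpace_fin, NNReal.coe_inv, hpc]
      change _ ≤ r⁻¹
      rw [hr, inv_inv, inv_inv]) Metric.isBounded_closedBall
  have hfg : ∀ t : ℝ≥0∞, eLpNorm (fderiv ℝ w) t volume = eLpNorm (gradient w) t volume :=
    fun t => eLpNorm_congr_norm_ae (.of_forall fun x => (norm_gradient w x).symm)
  have hsupp : Function.support (gradient w) ⊆ B :=
    (subset_tsupport _).trans ((IsTestFunction.tsupport_gradient_subset w).trans
      (closure_minimal hwB Metric.isClosed_closedBall))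
  -- Hölder on the ball returns from the exponent `p < 2` to the `L²` norm of the gradient.
  have hH := eLpNorm_le_eLpNorm_mul_rpow_measure_univ (μ := volume.restrict B) hp2'
    (hw.memLp_gradient 2).1.restrict
  rw [eLpNorm_restrict_eq_of_support_subset hsupp, eLpNorm_restrict_eq_of_support_subset hsupp,
    Measure.restrict_apply_univ] at hH
  rw [hfg] at hGNS
  have hfin : volume B ≠ ⊤ := measure_closedBall_lt_top.ne
  have h3 := hGNS.trans (mul_le_mul_right hH _)
  have h4 := ENNReal.toReal_mono (ENNReal.mul_ne_top ENNReal.coe_ne_top (ENNReal.mul_ne_top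
    (hw.memLp_gradient 2).eLpNorm_ne_top (ENNReal.rpow_ne_top_of_nonneg he0 hfin))) h3
  rw [ENNReal.toReal_mul, ENNReal.toReal_mul, ← ENNReal.toReal_rpow, toReal_eLpNorm (hw.memLp 2).1,
    toReal_eLpNorm (hw.memLp_gradient 2).1, hr'E] at h4
  refine h4.trans_eq ?_
  rw [ENNReal.coe_toReal]
  change _ = _ * (volume B).toReal ^ e * _
  ring

/-- Below the threshold `T` the first term suffices, above it the second. The free `T` replaces
Hölder interpolation: a large `T` makes the `r` term small. -/
lemma rpow_le_add_rpow {t T a q r : ℝ} (ht : 0 ≤ t) (hT : 0 < T) (ha : 0 < a) (haq : a < q)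
    (hqr : q < r) : t ^ q ≤ T ^ (q - a) * t ^ a + T ^ (q - r) * t ^ r := by
  have h1 : 0 ≤ T ^ (q - a) * t ^ a := by positivity
  have h2 : 0 ≤ T ^ (q - r) * t ^ r := by positivity
  rcases ht.eq_or_lt with rfl | ht
  · rw [Real.zero_rpow (by linarith)]; linarith
  rcases le_total t T with h | h
  · have h3 : t ^ (q - a) ≤ T ^ (q - a) := Real.rpow_le_rpow ht.le h (by linarith)
    have h4 : t ^ q = t ^ (q - a) * t ^ a := by rw [← Real.rpow_add ht]; ring_nf
    have h5 := mul_le_mul_of_nonneg_right h3 (Real.rpow_nonneg ht.le a)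
    linarith
  · have h3 : t ^ (q - r) ≤ T ^ (q - r) := Real.rpow_le_rpow_of_nonpos hT h (by linarith)
    have h4 : t ^ q = t ^ (q - r) * t ^ r := by rw [← Real.rpow_add ht]; ring_nf
    have h5 := mul_le_mul_of_nonneg_right h3 (Real.rpow_nonneg ht.le r)
    linarith

lemma lpNorm_rpow_eq_integral {α F : Type*} [MeasurableSpace α] [NormedAddCommGroup F]
    {μ : Measure α} {f : α → F} {q : ℝ} (hq : 0 < q) (hf : MemLp f (ENNReal.ofReal q) μ) :
    lpNorm f (ENNReal.ofReal q) μ ^ q = ∫ x, ‖f x‖ ^ q ∂μ := by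
  rw [lpNorm_eq_integral_norm_rpow_toReal (by simpa using hq) (by simp) hf.1,
    ENNReal.toReal_ofReal hq.le,
    ← Real.rpow_mul (integral_nonneg fun _ => Real.rpow_nonneg (norm_nonneg _) _),
    inv_mul_cancel₀ hq.ne', Real.rpow_one]

lemma IsTestFunction.integrable_rpow {N : ℕ} {U : Set (Euc N)} {w : Euc N → ℝ}
    (hw : IsTestFunction U w) {q : ℝ} (hq : 0 < q) : Integrable (fun x => ‖w x‖ ^ q) volume := by
  have := (hw.memLp (ENNReal.ofReal q)).integrable_norm_rpow (by simpa using hq) (by simp)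
  rwa [ENNReal.toReal_ofReal hq.le] at this

lemma IsTestFunction.lpNorm_rpow_le {N : ℕ} {U : Set (Euc N)} {w : Euc N → ℝ}
    (hw : IsTestFunction U w) {q r T : ℝ} (hT : 0 < T) (hq : 2 < q) (hqr : q < r) :
    lpNorm w (ENNReal.ofReal q) volume ^ q ≤ T ^ (q - 2) * lpNorm w 2 volume ^ 2
      + T ^ (q - r) * lpNorm w (ENNReal.ofReal r) volume ^ r := by
  rw [lpNorm_rpow_eq_integral (by linarith) (hw.memLp _),
    lpNorm_rpow_eq_integral (by linarith) (hw.memLp _), hw.lpNorm_sq, ← integral_const_mul,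
    ← integral_const_mul,
    ← integral_add (hw.integrable_sq.const_mul _) ((hw.integrable_rpow (by linarith)).const_mul _)]
  refine integral_mono (hw.integrable_rpow (by linarith))
    ((hw.integrable_sq.const_mul _).add ((hw.integrable_rpow (by linarith)).const_mul _))
    fun x => ?_
  have := rpow_le_add_rpow (norm_nonneg (w x)) hT two_pos hq hqr
  simpa using this

/-- Local `L²` convergence to zero of a sequence which is bounded in `W^{1,2}` improves to local
`L^q` convergence, for subcritical `q`. -/
lemma IsCutoffAngle.tendsto_lpNorm_cos_mul {N : ℕ} (hN : 2 ≤ N) {q : ℝ} (hq : 2 < q)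
    (hsub : N * (1 - 2 / q) < 2) {L S M : ℝ} {θ : Euc N → ℝ} (h : IsCutoffAngle L S θ)
    {ι : Type*} {F : Filter ι} {U : Set (Euc N)} {w : ι → Euc N → ℝ}
    (hw : ∀ i, IsTestFunction U (w i)) (hM : ∀ i, lpNorm (w i) 2 volume ≤ M)
    (hM' : ∀ i, lpNorm (gradient (w i)) 2 volume ≤ M)
    (hlim : Tendsto (fun i => ∫ x in Metric.closedBall 0 (2 * S), w i x ^ 2) F (𝓝 0)) :
    Tendsto (fun i => lpNorm (fun x => Real.cos (θ x) * w i x) (ENNReal.ofReal q) volume)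
      F (𝓝 0) := by
  obtain ⟨r, hqr, C, hC, hSob⟩ := exists_lpNorm_le_lpNorm_gradient hN hq hsub (2 * S)
  have hc : ∀ i, IsTestFunction U (fun x => Real.cos (θ x) * w i x) :=
    fun i => (hw i).cos_mul h.contDiff
  set D : ℝ := Real.sqrt (M ^ 2 + (L / S) ^ 2 * M ^ 2) with hD
  have hg : ∀ i, lpNorm (gradient fun x => Real.cos (θ x) * w i x) 2 volume ≤ D := by
    intro i
    refine Real.le_sqrt_of_sq_le ?_
    have h1 := h.lpNorm_gradient_le (hw i)
    have h2 : ∫ x in Metric.closedBall 0 (2 * S), w i x ^ 2 ≤ M ^ 2 := by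
      refine (setIntegral_le_integral (hw i).integrable_sq
        (.of_forall fun _ => sq_nonneg _)).trans ?_
      rw [← (hw i).lpNorm_sq]
      exact pow_le_pow_left₀ lpNorm_nonneg (hM i) 2
    have h3 := pow_le_pow_left₀ lpNorm_nonneg (hM' i) 2
    have h4 := mul_le_mul_of_nonneg_left h2 (sq_nonneg (L / S))
    linarith [sq_nonneg (lpNorm (gradient fun x => Real.sin (θ x) * w i x) 2 volume)]
  have hsupp : ∀ i, Function.support (fun x => Real.cos (θ x) * w i x)
      ⊆ Metric.closedBall 0 (2 * S) := by
    intro i x hx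
    by_contra hxB
    exact hx (by simp [h.cos_eq_zero (not_le.1 (by simpa using hxB)).le])
  have hr : ∀ i, lpNorm (fun x => Real.cos (θ x) * w i x) (ENNReal.ofReal r) volume ^ r
      ≤ (C * D) ^ r := fun i => Real.rpow_le_rpow lpNorm_nonneg
    ((hSob U _ (hc i) (hsupp i)).trans (mul_le_mul_of_nonneg_left (hg i) hC)) (by linarith)
  have h2 : ∀ i, lpNorm (fun x => Real.cos (θ x) * w i x) 2 volume ^ 2
      ≤ ∫ x in Metric.closedBall 0 (2 * S), w i x ^ 2 := by
    intro i
    rw [(hc i).lpNorm_sq, ← integral_indicator measurableSet_closedBall]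
    refine integral_mono (hc i).integrable_sq
      ((hw i).integrable_sq.indicator measurableSet_closedBall) fun x => ?_
    simp only []
    by_cases hx : x ∈ Metric.closedBall (0 : Euc N) (2 * S)
    · rw [Set.indicator_of_mem hx, mul_pow]
      exact mul_le_of_le_one_left (sq_nonneg _) (Real.cos_sq_le_one _)
    · rw [Set.indicator_of_notMem hx, h.cos_eq_zero (not_le.1 (by simpa using hx)).le]
      simp
  have hpow : Tendsto
      (fun i => lpNorm (fun x => Real.cos (θ x) * w i x) (ENNReal.ofReal q) volume ^ q)
      F (𝓝 0) := by
    rw [Metric.tendsto_nhds]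
    intro δ hδ
    have hT : Tendsto (fun T : ℝ => T ^ (-(r - q)) * (C * D) ^ r) atTop (𝓝 0) := by
      simpa using (tendsto_rpow_neg_atTop (by linarith : 0 < r - q)).mul_const ((C * D) ^ r)
    -- `T` is fixed first, so that the bounded `L^r` part is small. Only then does the local `L²`
    -- convergence beat the factor `T ^ (q - 2)`.
    obtain ⟨T, hT1, hT0⟩ := ((hT.eventually (gt_mem_nhds (half_pos hδ))).and
      (eventually_gt_atTop 0)).exists
    rw [neg_sub] at hT1
    have hlim' := hlim.const_mul (T ^ (q - 2))
    rw [mul_zero] at hlim'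
    filter_upwards [hlim'.eventually (gt_mem_nhds (half_pos hδ))] with i hi
    rw [Real.dist_eq, sub_zero, abs_of_nonneg (Real.rpow_nonneg lpNorm_nonneg _)]
    have e1 := (hc i).lpNorm_rpow_le hT0 hq hqr
    have e2 := mul_le_mul_of_nonneg_left (hr i) (Real.rpow_nonneg hT0.le (q - r))
    have e3 := mul_le_mul_of_nonneg_left (h2 i) (Real.rpow_nonneg hT0.le (q - 2))
    linarith
  have hq0 : 0 < q := by linarith
  have := hpow.rpow_const (p := q⁻¹) (Or.inr (by positivity))
  rw [Real.zero_rpow (by positivity)] at this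
  refine this.congr fun i => ?_
  rw [← Real.rpow_mul lpNorm_nonneg, mul_inv_cancel₀ hq0.ne', Real.rpow_one]

/-! ### Strong limits, weak gradients and the parallelogram law -/

/-- Completeness of `L^p` in terms of functions. -/
lemma exists_tendsto_eLpNorm_sub {α F : Type*} [MeasurableSpace α] [NormedAddCommGroup F]
    [CompleteSpace F] {μ : Measure α} {p : ℝ≥0∞} (hp : 1 ≤ p) {f : ℕ → α → F}
    (hf : ∀ n, MemLp (f n) p μ)
    (h : Tendsto (fun i : ℕ × ℕ => lpNorm (fun x => f i.1 x - f i.2 x) p μ)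
      (atTop ×ˢ atTop) (𝓝 0)) :
    ∃ u : α → F, MemLp u p μ ∧ Tendsto (fun n => eLpNorm (fun x => f n x - u x) p μ) atTop (𝓝 0) ∧
      Tendsto (fun n => lpNorm (f n) p μ) atTop (𝓝 (lpNorm u p μ)) := by
  have : Fact (1 ≤ p) := ⟨hp⟩
  have hc : CauchySeq fun n => (hf n).toLp (f n) := by
    rw [cauchySeq_iff_tendsto, tendsto_uniformity_iff_dist_tendsto_zero,
      ← prod_atTop_atTop_eq]
    refine h.congr fun i => ?_
    rw [Prod.map_fst, Prod.map_snd, dist_eq_norm, ← MemLp.toLp_sub, Lp.norm_toLp,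
      toReal_eLpNorm ((hf _).sub (hf _)).1]
    rfl
  obtain ⟨g, hg⟩ := cauchySeq_tendsto_of_complete hc
  refine ⟨g, Lp.memLp g, ?_, ?_⟩
  · have h1 := (Lp.tendsto_Lp_iff_tendsto_eLpNorm' _ _).1 hg
    refine h1.congr fun n => ?_
    exact eLpNorm_congr_ae (((hf n).coeFn_toLp).mono fun x hx => by simp [hx])
  · refine ((hg.norm).congr fun n => ?_).trans (by
      rw [Lp.norm_def, toReal_eLpNorm (Lp.aestronglyMeasurable g)])
    rw [Lp.norm_toLp, toReal_eLpNorm (hf n).1]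

lemma lpNorm_restrict_le {α F : Type*} [MeasurableSpace α] [NormedAddCommGroup F] {μ : Measure α}
    {p : ℝ≥0∞} {f : α → F} (hf : MemLp f p μ) (s : Set α) :
    lpNorm f p (μ.restrict s) ≤ lpNorm f p μ := by
  rw [← toReal_eLpNorm hf.1, ← toReal_eLpNorm hf.1.restrict]
  exact ENNReal.toReal_mono hf.eLpNorm_ne_top (eLpNorm_mono_measure f Measure.restrict_le_self)

lemma exists_tendsto_eLpNorm_sub_restrict {α F : Type*} [MeasurableSpace α] [NormedAddCommGroup F]
    [CompleteSpace F] {μ : Measure α} {p : ℝ≥0∞} (hp : 1 ≤ p) {f : ℕ → α → F}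
    (hf : ∀ n, MemLp (f n) p μ)
    (h : Tendsto (fun i : ℕ × ℕ => lpNorm (fun x => f i.1 x - f i.2 x) p μ)
      (atTop ×ˢ atTop) (𝓝 0)) (s : Set α) :
    ∃ u : α → F, MemLp u p (μ.restrict s) ∧
      Tendsto (fun n => eLpNorm (fun x => f n x - u x) p (μ.restrict s)) atTop (𝓝 0) ∧
      Tendsto (fun n => lpNorm (f n) p (μ.restrict s)) atTop (𝓝 (lpNorm u p (μ.restrict s))) :=
  exists_tendsto_eLpNorm_sub hp (fun n => (hf n).restrict s)
    (squeeze_zero (fun _ => lpNorm_nonneg)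
      (fun i => lpNorm_restrict_le ((hf i.1).sub (hf i.2)) s) h)

section WeakGradient

variable {N : ℕ} {U : Set (Euc N)} {φ ψ : Euc N → ℝ}

/-- Integration by parts for test functions. -/
lemma IsTestFunction.integral_smul_gradient (hφ : IsTestFunction U φ) (hψ : IsTestFunction U ψ) :
    ∫ x, φ x • gradient ψ x = - ∫ x, ψ x • gradient φ x := by
  have hφc := hφ.1.continuous
  have hψc := hψ.1.continuous
  have hφg := hφ.1.continuous_gradient
  have hψg := hψ.1.continuous_gradient
  have i1 : Integrable (fun x => φ x • gradient ψ x) volume :=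
    (hφc.smul hψg).integrable_of_hasCompactSupport hφ.2.1.smul_right
  have i2 : Integrable (fun x => ψ x • gradient φ x) volume :=
    (hψc.smul hφg).integrable_of_hasCompactSupport hψ.2.1.smul_right
  refine ext_inner_left ℝ fun v => ?_
  rw [inner_neg_right, ← integral_inner i1, ← integral_inner i2]
  have e1 : ∀ x, inner ℝ v (φ x • gradient ψ x) = φ x * fderiv ℝ ψ x v := by
    intro x
    rw [inner_smul_right, real_inner_comm, inner_gradient_left]
  have e2 : ∀ x, inner ℝ v (ψ x • gradient φ x) = fderiv ℝ φ x v * ψ x := by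
    intro x
    rw [inner_smul_right, real_inner_comm, inner_gradient_left, mul_comm]
  have j1 := i1.const_inner (𝕜 := ℝ) v
  have j2 := i2.const_inner (𝕜 := ℝ) v
  simp_rw [e1] at j1 ⊢
  simp_rw [e2] at j2 ⊢
  exact integral_mul_fderiv_eq_neg_fderiv_mul_of_integrable j2 j1
    ((hφc.mul hψc).integrable_of_hasCompactSupport hφ.2.1.mul_right)
    (fun x _ => hφ.1.differentiable (by simp) x) (fun x _ => hψ.1.differentiable (by simp) x)

/-- Weak gradients are stable under strong convergence in `L²`. -/
lemma isWeakGradient_of_tendsto {φ : ℕ → Euc N → ℝ} {u : Euc N → ℝ} {G : Euc N → Euc N}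
    (hφ : ∀ n, IsTestFunction U (φ n)) (hu : MemLp u 2 (volume.restrict U))
    (hG : MemLp G 2 (volume.restrict U))
    (hφu : Tendsto (fun n => eLpNorm (fun x => φ n x - u x) 2 (volume.restrict U)) atTop (𝓝 0))
    (hφG : Tendsto (fun n => eLpNorm (fun x => gradient (φ n) x - G x) 2 (volume.restrict U))
      atTop (𝓝 0)) : IsWeakGradient U u G := by
  intro ψ hψ
  set μ := volume.restrict U
  have m1 : ∀ n, MemLp (φ n) 2 μ := fun n => ((hφ n).memLp 2).restrict U
  have m2 : ∀ n, MemLp (gradient (φ n)) 2 μ := fun n => ((hφ n).memLp_gradient 2).restrict U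
  have m3 : MemLp ψ 2 μ := (hψ.memLp 2).restrict U
  have m4 : MemLp (gradient ψ) 2 μ := (hψ.memLp_gradient 2).restrict U
  have l1 : Tendsto (fun n => ∫ x, φ n x • gradient ψ x ∂μ) atTop
      (𝓝 (∫ x, u x • gradient ψ x ∂μ)) := by
    refine tendsto_integral_of_L1' _ (m4.smul (r := 1) hu).1
      (.of_forall fun n => memLp_one_iff_integrable.1 (m4.smul (m1 n))) ?_
    have hz : Tendsto (fun n => eLpNorm (fun x => φ n x - u x) 2 μ * eLpNorm (gradient ψ) 2 μ)
        atTop (𝓝 0) := by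
      simpa using ENNReal.Tendsto.mul_const hφu (Or.inr m4.eLpNorm_ne_top)
    refine tendsto_of_tendsto_of_tendsto_of_le_of_le tendsto_const_nhds hz
      (fun n => zero_le) fun n => ?_
    have := eLpNorm_smul_le_mul_eLpNorm (p := 2) (q := 2) (r := 1) m4.1 ((m1 n).sub hu).1
    refine le_of_eq_of_le ?_ this
    congr 1
    funext x
    simp [sub_smul]
  have l2 : Tendsto (fun n => ∫ x, ψ x • gradient (φ n) x ∂μ) atTop
      (𝓝 (∫ x, ψ x • G x ∂μ)) := by
    refine tendsto_integral_of_L1' _ (hG.smul (r := 1) m3).1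
      (.of_forall fun n => memLp_one_iff_integrable.1 ((m2 n).smul m3)) ?_
    have hz : Tendsto (fun n => eLpNorm ψ 2 μ * eLpNorm (fun x => gradient (φ n) x - G x) 2 μ)
        atTop (𝓝 0) := by
      simpa using ENNReal.Tendsto.const_mul hφG (Or.inr m3.eLpNorm_ne_top)
    refine tendsto_of_tendsto_of_tendsto_of_le_of_le tendsto_const_nhds hz
      (fun n => zero_le) fun n => ?_
    have := eLpNorm_smul_le_mul_eLpNorm (p := 2) (q := 2) (r := 1) ((m2 n).sub hG).1 m3.1
    refine le_of_eq_of_le ?_ this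
    congr 1
    funext x
    simp [smul_sub]
  refine tendsto_nhds_unique l1 (l2.neg.congr fun n => ?_)
  have s1 : ∫ x in U, φ n x • gradient ψ x = ∫ x, φ n x • gradient ψ x :=
    setIntegral_eq_integral_of_forall_compl_eq_zero fun x hx => by
      rw [Function.notMem_support.1 fun h => hx ((hφ n).support_subset h), zero_smul]
  have s2 : ∫ x in U, ψ x • gradient (φ n) x = ∫ x, ψ x • gradient (φ n) x :=
    setIntegral_eq_integral_of_forall_compl_eq_zero fun x hx => by
      rw [Function.notMem_support.1 fun h => hx (hψ.support_subset h), zero_smul]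
  rw [s1, s2, (hφ n).integral_smul_gradient hψ]

end WeakGradient

section Cauchy

variable {N : ℕ} {U : Set (Euc N)} {φ ψ : Euc N → ℝ}

/-- The parallelogram law: two almost minimizers which are close in `L^q` have close gradients. -/
lemma IsTestFunction.lpNorm_gradient_sub_sq_le {q : ℝ≥0∞} (hq : 1 ≤ q) {l : ℝ} (hl : 0 ≤ l)
    (hlU : ENNReal.ofReal l ≤ poincareSobolev 2 q U) (hφ : IsTestFunction U φ)
    (hψ : IsTestFunction U ψ) (hφ1 : lpNorm φ q volume = 1) :
    lpNorm (gradient fun x => φ x - ψ x) 2 volume ^ 2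
      ≤ 2 * lpNorm (gradient φ) 2 volume ^ 2 + 2 * lpNorm (gradient ψ) 2 volume ^ 2
        - 4 * l + 4 * l * lpNorm (fun x => φ x - ψ x) q volume := by
  have hs := hφ.sub hψ
  have ha := hφ.add hψ
  have e1 : lpNorm (gradient fun x => φ x + ψ x) 2 volume ^ 2
      + lpNorm (gradient fun x => φ x - ψ x) 2 volume ^ 2
      = 2 * lpNorm (gradient φ) 2 volume ^ 2 + 2 * lpNorm (gradient ψ) 2 volume ^ 2 := by
    rw [hs.lpNorm_gradient_sq, ha.lpNorm_gradient_sq, hφ.lpNorm_gradient_sq, hψ.lpNorm_gradient_sq,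
      ← integral_const_mul, ← integral_const_mul, ← integral_add ha.integrable_gradient_sq
      hs.integrable_gradient_sq, ← integral_add (hφ.integrable_gradient_sq.const_mul _)
      (hψ.integrable_gradient_sq.const_mul _)]
    congr 1 with x
    rw [hφ.gradient_sub hψ, hφ.gradient_add hψ]
    have := parallelogram_law_with_norm ℝ (gradient φ x) (gradient ψ x)
    simp only []
    linarith
  have e2 := ha.mul_lpNorm_sq_le hlU
  have e3 : 2 ≤ lpNorm (fun x => φ x + ψ x) q volume + lpNorm (fun x => φ x - ψ x) q volume := by
    have h1 := lpNorm_add_le (g := fun x => φ x - ψ x) (ha.memLp q) hq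
    have h2 : ((fun x => φ x + ψ x) + fun x => φ x - ψ x) = (2 : ℝ) • φ := by
      funext x; simp; ring
    rw [h2, lpNorm_const_smul, hφ1] at h1
    simpa using h1
  set a := lpNorm (fun x => φ x + ψ x) q volume
  set d := lpNorm (fun x => φ x - ψ x) q volume
  -- The tangent line `4 * a - 4` lies below `a ^ 2`, so `a ≥ 2 - d` is enough, whatever the sign of
  -- `2 - d`.
  have e4 : 4 - 4 * d ≤ a ^ 2 := by nlinarith [sq_nonneg (a - 2)]
  nlinarith [mul_le_mul_of_nonneg_left e4 hl]

end Cauchy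

/-! ### Minimizing sequences and their compactness -/

/-- One scaling inequality covers `N = 2` and `N ≥ 3`, so that no later estimate has to distinguish
them. -/
lemma IsSubcritical.ne_top_and_lt {N : ℕ} (hN : 2 ≤ N) {q : ℝ≥0∞} (hq : 2 < q)
    (h : IsSubcritical N 2 q) : q ≠ ⊤ ∧ (N : ℝ) * (1 - 2 / q.toReal) < 2 := by
  have hpos : ∀ _ : q ≠ ⊤, 0 < q.toReal := fun ht =>
    ENNReal.toReal_pos (by rintro rfl; simp at hq) ht
  rcases hN.eq_or_lt with rfl | hN
  · have ht := (h.2 (by norm_num)).ne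
    have h0 := hpos ht
    refine ⟨ht, ?_⟩
    have : 0 < 2 / q.toReal := by positivity
    push_cast; linarith
  · have hN' : (2 : ℝ) < N := by exact_mod_cast hN
    have h1 := h.1 hN'
    have ht := h1.ne_top
    have h0 := hpos ht
    refine ⟨ht, ?_⟩
    have h2 : q.toReal < N * 2 / (N - 2) := by
      have := (ENNReal.toReal_lt_toReal ht (by simp)).2 h1
      rwa [ENNReal.toReal_ofReal (div_nonneg (by positivity) (by linarith))] at this
    rw [lt_div_iff₀ (by linarith)] at h2
    have h3 : (N - 2 : ℝ) < N * 2 / q.toReal := by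
      rw [lt_div_iff₀ h0]; linarith
    have h4 : (N : ℝ) * (1 - 2 / q.toReal) = N - N * 2 / q.toReal := by ring
    linarith

/-- A minimizing sequence of normalized test functions. -/
lemma exists_minimizing_sequence {N : ℕ} {q : ℝ≥0∞} {U : Set (Euc N)}
    (hfin : poincareSobolev 2 q U ≠ ⊤) :
    ∃ φ : ℕ → Euc N → ℝ, (∀ n, IsTestFunction U (φ n)) ∧ (∀ n, lpNorm (φ n) q volume = 1) ∧
      ∀ n, lpNorm (gradient (φ n)) 2 volume ^ 2
        ≤ (poincareSobolev 2 q U).toReal + 1 / ((n : ℝ) + 1) := by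
  have key : ∀ n : ℕ, ∃ φ : Euc N → ℝ, IsTestFunction U φ ∧ lpNorm φ q volume = 1 ∧
      lpNorm (gradient φ) 2 volume ^ 2
        ≤ (poincareSobolev 2 q U).toReal + 1 / ((n : ℝ) + 1) := by
    intro n
    have hn : (0 : ℝ) < 1 / ((n : ℝ) + 1) := by positivity
    have h1 : poincareSobolev 2 q U
        < poincareSobolev 2 q U + ENNReal.ofReal (1 / ((n : ℝ) + 1)) :=
      ENNReal.lt_add_right hfin (by simpa using hn)
    nth_rw 1 [poincareSobolev] at h1
    simp only [iInf_lt_iff] at h1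
    obtain ⟨φ, hφ, hφ1, hlt⟩ := h1
    refine ⟨φ, hφ, ?_, ?_⟩
    · rw [eLpNorm_restrict_eq_of_support_subset hφ.support_subset] at hφ1
      rw [← toReal_eLpNorm (hφ.memLp q).1, hφ1, ENNReal.toReal_one]
    · have h2 : ∫⁻ x in U, ‖gradient φ x‖ₑ ^ (2 : ℝ)
          = ENNReal.ofReal (lpNorm (gradient φ) 2 volume ^ 2) := by
        rw [ofReal_lpNorm_two_sq (hφ.memLp_gradient 2)]
        refine setLIntegral_eq_of_support_subset ?_
        intro x hx
        refine hφ.support_gradient_subset fun h0 => hx ?_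
        simp [h0]
      rw [h2, ← ENNReal.ofReal_toReal hfin, ← ENNReal.ofReal_add ENNReal.toReal_nonneg hn.le] at hlt
      exact (ENNReal.ofReal_lt_ofReal_iff (by positivity)).1 hlt |>.le
  choose φ h1 h2 h3 using key
  exact ⟨φ, h1, h2, h3⟩

section Compactness

variable {N : ℕ} {U : Set (Euc N)} {q : ℝ≥0∞} {l c R M : ℝ} {φ : ℕ → Euc N → ℝ}

/-- A minimizing sequence which is Cauchy in `L²_loc` is Cauchy in `L^q`, provided that the
constant outside a ball is larger than the global one. -/
lemma tendsto_lpNorm_sub (hN : 2 ≤ N) (hq : 2 < q) (hqt : q ≠ ⊤)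
    (hsub : N * (1 - 2 / q.toReal) < 2) (hl : 0 ≤ l) (hlc : l < c)
    (hlU : ENNReal.ofReal l ≤ poincareSobolev 2 q U)
    (hcU : ENNReal.ofReal c ≤ poincareSobolev 2 q (U \ Metric.closedBall 0 R))
    (hφ : ∀ n, IsTestFunction U (φ n)) (hφ1 : ∀ n, lpNorm (φ n) q volume = 1)
    (hg : Tendsto (fun n => lpNorm (gradient (φ n)) 2 volume ^ 2) atTop (𝓝 l))
    (hM : ∀ n, lpNorm (φ n) 2 volume ≤ M) (hM' : ∀ n, lpNorm (gradient (φ n)) 2 volume ≤ M)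
    (hloc : ∀ r : ℝ, Tendsto
      (fun p : ℕ × ℕ => ∫ x in Metric.closedBall 0 r, (φ p.1 x - φ p.2 x) ^ 2)
      (atTop ×ˢ atTop) (𝓝 0)) :
    Tendsto (fun p : ℕ × ℕ => lpNorm (fun x => φ p.1 x - φ p.2 x) q volume)
      (atTop ×ˢ atTop) (𝓝 0) := by
  have hq1 : 1 ≤ q := le_trans (by norm_num) hq.le
  have hq2 : 2 < q.toReal := by simpa using (ENNReal.toReal_lt_toReal (by simp) hqt).2 hq
  obtain ⟨L, hL, hcut⟩ := exists_isCutoffAngle N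
  have hcl : 0 < c - l := sub_pos.2 hlc
  rw [Metric.tendsto_nhds]
  intro δ hδ
  -- The allowance for the outer mass, `(c - l) * (δ / 4) ^ 2`, is shared equally: half for the
  -- localization error, by the choice of `S`, and half for the energy excess of late terms.
  have hSlim : Tendsto (fun S : ℝ => (L * S⁻¹) ^ 2 * M ^ 2) atTop (𝓝 0) := by
    simpa using ((tendsto_inv_atTop_zero.const_mul L).pow 2).mul_const (M ^ 2)
  obtain ⟨S, hS1, hSR, hS0⟩ := ((hSlim.eventually (gt_mem_nhds
    (by positivity : 0 < (c - l) * (δ / 4) ^ 2 / 2))).and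
    ((eventually_gt_atTop R).and (eventually_gt_atTop 0))).exists
  rw [← div_eq_mul_inv] at hS1
  obtain ⟨θ, hθ⟩ := hcut S hS0
  have hw : ∀ p : ℕ × ℕ, IsTestFunction U (fun x => φ p.1 x - φ p.2 x) :=
    fun p => (hφ _).sub (hφ _)
  have hcos := hθ.tendsto_lpNorm_cos_mul hN hq2 hsub (M := 2 * M) (F := atTop ×ˢ atTop) hw
    (fun p => (lpNorm_sub_le ((hφ p.1).memLp 2) (by norm_num)).trans
      (by linarith [hM p.1, hM p.2]))
    (fun p => by
      rw [(hφ _).gradient_sub (hφ _)]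
      exact (lpNorm_sub_le ((hφ p.1).memLp_gradient 2) (by norm_num)).trans
        (by linarith [hM' p.1, hM' p.2])) (hloc _)
  rw [ENNReal.ofReal_toReal hqt] at hcos
  have hsin : ∀ᶠ n in atTop, lpNorm (fun x => Real.sin (θ x) * φ n x) q volume < δ / 4 := by
    filter_upwards [hg.eventually (gt_mem_nhds
      (by linarith [show 0 < (c - l) * (δ / 4) ^ 2 / 2 by positivity] :
        l < l + (c - l) * (δ / 4) ^ 2 / 2))] with n hn
    have h1 := hθ.mul_lpNorm_sin_sq_le hq.le hl hSR hlU hcU (hφ n) (hφ1 n)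
    have h2 := mul_le_mul_of_nonneg_left (pow_le_pow_left₀ lpNorm_nonneg (hM n) 2)
      (sq_nonneg (L / S))
    have h3 : (c - l) * lpNorm (fun x => Real.sin (θ x) * φ n x) q volume ^ 2
        < (c - l) * (δ / 4) ^ 2 := by linarith
    exact lt_of_pow_lt_pow_left₀ 2 (by positivity) (lt_of_mul_lt_mul_left h3 hcl.le)
  filter_upwards [hcos.eventually (gt_mem_nhds (by positivity : 0 < δ / 4)),
    (tendsto_fst (f := atTop) (g := atTop)).eventually hsin,
    (tendsto_snd (f := atTop) (g := atTop)).eventually hsin] with p hp1 hp2 hp3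
  rw [Real.dist_eq, sub_zero, abs_of_nonneg lpNorm_nonneg]
  have hc := (hw p).cos_mul hθ.contDiff
  have hs := (hw p).sin_mul hθ.contDiff
  have hr := (hw p).sub hc
  have t1 : lpNorm (fun x => φ p.1 x - φ p.2 x) q volume
      ≤ lpNorm (fun x => Real.cos (θ x) * (φ p.1 x - φ p.2 x)) q volume
        + lpNorm (fun x => (φ p.1 x - φ p.2 x) - Real.cos (θ x) * (φ p.1 x - φ p.2 x)) q volume := by
    refine le_of_eq_of_le ?_ (lpNorm_add_le (hc.memLp q) hq1)
    congr 1
    funext x; simp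
  have t2 : lpNorm (fun x => (φ p.1 x - φ p.2 x) - Real.cos (θ x) * (φ p.1 x - φ p.2 x)) q volume
      ≤ lpNorm (fun x => Real.sin (θ x) * (φ p.1 x - φ p.2 x)) q volume := by
    refine lpNorm_mono (hr.memLp q) (hs.memLp q) fun x => ?_
    rw [← one_sub_mul, norm_mul, norm_mul, Real.norm_of_nonneg (hθ.sin_nonneg x),
      Real.norm_of_nonneg (sub_nonneg.2 (Real.cos_le_one _))]
    exact mul_le_mul_of_nonneg_right (hθ.one_sub_cos_le x) (norm_nonneg _)
  have t3 : lpNorm (fun x => Real.sin (θ x) * (φ p.1 x - φ p.2 x)) q volume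
      ≤ lpNorm (fun x => Real.sin (θ x) * φ p.1 x) q volume
        + lpNorm (fun x => Real.sin (θ x) * φ p.2 x) q volume := by
    refine le_of_eq_of_le ?_
      (lpNorm_sub_le (((hφ p.1).sin_mul hθ.contDiff).memLp q) hq1)
    congr 1
    funext x; simp [mul_sub]
  linarith

end Compactness

/-! ### Existence of the extremal -/

theorem mainTheorem7 {N : ℕ} (hN : 2 ≤ N) (q : ℝ≥0∞) (hq : 2 < q)
    (hsub : IsSubcritical N 2 q)
    (Ω : Set (EuclideanSpace ℝ (Fin N))) (hΩ : IsOpen Ω)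
    (hlt : poincareSobolev 2 q Ω < poincareSobolevAtInfinity 2 q Ω) :
    ∃ u : EuclideanSpace ℝ (Fin N) → ℝ, IsExtremal 2 q Ω u := by
  obtain ⟨hqt, hsub'⟩ := hsub.ne_top_and_lt hN hq
  have hq1 : 1 ≤ q := le_trans (by norm_num) hq.le
  have hq0 : q ≠ 0 := (zero_lt_one.trans_le hq1).ne'
  have hfin : poincareSobolev 2 q Ω ≠ ⊤ := hlt.ne_top
  simp only [poincareSobolevAtInfinity, lt_iSup_iff] at hlt
  obtain ⟨R, hR, hlt⟩ := hlt
  set l := (poincareSobolev 2 q Ω).toReal with hldef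
  have hl : 0 ≤ l := ENNReal.toReal_nonneg
  have hlof : ENNReal.ofReal l = poincareSobolev 2 q Ω := ENNReal.ofReal_toReal hfin
  -- The constant outside the ball may be infinite, so a finite value in between is used.
  obtain ⟨c', hc'1, hc'2⟩ := ENNReal.lt_iff_exists_nnreal_btwn.1 hlt
  obtain ⟨c, hcdef⟩ : ∃ c : ℝ, c = (c' : ℝ) := ⟨_, rfl⟩
  have hcU : ENNReal.ofReal c ≤ poincareSobolev 2 q (Ω \ Metric.closedBall 0 R) := by
    rw [hcdef, ENNReal.ofReal_coe_nnreal]; exact hc'2.le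
  have hlc : l < c := by
    have := (ENNReal.toReal_lt_toReal hfin ENNReal.coe_ne_top).2 hc'1
    rwa [ENNReal.coe_toReal, ← hcdef] at this
  have hc : 0 < c := hl.trans_lt hlc
  obtain ⟨C, hC, hP⟩ := exists_lpNorm_two_sq_le_add hq.le hsub' hc hR hcU
  obtain ⟨Φ, hΦ, hΦ1, hΦg⟩ := exists_minimizing_sequence hfin
  have hΦg' : ∀ n, lpNorm (gradient (Φ n)) 2 volume ^ 2 ≤ l + 1 := fun n => by
    refine (hΦg n).trans ?_
    rw [← hldef]
    gcongr
    rw [div_le_one (by positivity)]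
    linarith [(Nat.cast_nonneg n : (0 : ℝ) ≤ n)]
  -- Under the root, the product dominates both `C * (l + 2)`, from the `L²` estimate, and `l + 1`,
  -- from the energy.
  set M := Real.sqrt ((C + 1) * (l + 2)) with hM
  have hΦM : ∀ n, lpNorm (Φ n) 2 volume ≤ M := fun n => by
    refine Real.le_sqrt_of_sq_le ((hP _ (hΦ n)).trans ?_)
    rw [hΦ1 n]
    nlinarith [hΦg' n]
  have hΦM' : ∀ n, lpNorm (gradient (Φ n)) 2 volume ≤ M := fun n => by
    refine Real.le_sqrt_of_sq_le ((hΦg' n).trans ?_)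
    nlinarith
  obtain ⟨k, hk, hloc⟩ := exists_subseq_tendsto_setIntegral_sq_sub hΦ hΦM hΦM'
  set φ : ℕ → Euc N → ℝ := fun n => Φ (k n) with hφdef
  have hφ : ∀ n, IsTestFunction Ω (φ n) := fun n => hΦ _
  have hφ1 : ∀ n, lpNorm (φ n) q volume = 1 := fun n => hΦ1 _
  have hg : Tendsto (fun n => lpNorm (gradient (φ n)) 2 volume ^ 2) atTop (𝓝 l) := by
    refine Tendsto.comp (g := fun n => lpNorm (gradient (Φ n)) 2 volume ^ 2) ?_ hk.tendsto_atTop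
    refine tendsto_of_tendsto_of_tendsto_of_le_of_le tendsto_const_nhds
      (h := fun n : ℕ => l + 1 / ((n : ℝ) + 1)) ?_ (fun n => ?_) (fun n => hΦg n)
    · simpa using tendsto_one_div_add_atTop_nhds_zero_nat.const_add l
    · have := (hΦ n).mul_lpNorm_sq_le hlof.le
      simpa [hΦ1 n] using this
  have cq := tendsto_lpNorm_sub hN hq hqt hsub' hl hlc hlof.le hcU hφ hφ1 hg
    (fun n => hΦM _) (fun n => hΦM' _) hloc
  have cg2 : Tendsto (fun p : ℕ × ℕ =>
      lpNorm (gradient fun x => φ p.1 x - φ p.2 x) 2 volume ^ 2) (atTop ×ˢ atTop) (𝓝 0) := by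
    refine squeeze_zero (fun _ => sq_nonneg _) (fun p => (hφ p.1).lpNorm_gradient_sub_sq_le hq1 hl
      hlof.le (hφ p.2) (hφ1 p.1)) ?_
    have := ((((hg.comp tendsto_fst).const_mul 2).add
      ((hg.comp (tendsto_snd (f := atTop (α := ℕ)))).const_mul 2)).sub_const (4 * l)).add
      (cq.const_mul (4 * l))
    refine this.trans (by ring_nf; exact le_rfl)
  have hsq : ∀ {F : Filter (ℕ × ℕ)} {f : ℕ × ℕ → ℝ}, (∀ p, 0 ≤ f p) →
      Tendsto (fun p => f p ^ 2) F (𝓝 0) → Tendsto f F (𝓝 0) := fun {F f} h0 h => by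
    have := h.sqrt
    rw [Real.sqrt_zero] at this
    exact this.congr fun p => Real.sqrt_sq (h0 p)
  have cg : Tendsto (fun p : ℕ × ℕ =>
      lpNorm (fun x => gradient (φ p.1) x - gradient (φ p.2) x) 2 volume)
      (atTop ×ˢ atTop) (𝓝 0) :=
    (hsq (fun _ => lpNorm_nonneg) cg2).congr fun p => by rw [(hφ p.1).gradient_sub (hφ p.2)]
  have c2 : Tendsto (fun p : ℕ × ℕ => lpNorm (fun x => φ p.1 x - φ p.2 x) 2 volume)
      (atTop ×ˢ atTop) (𝓝 0) := by
    -- Applied to differences, the Poincaré bound turns Cauchy in `L^q` and in energy into Cauchy in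
    -- global `L²`, as membership in `W₀^{1,2}` requires.
    refine hsq (fun _ => lpNorm_nonneg) (squeeze_zero (fun _ => sq_nonneg _)
      (fun p => hP _ ((hφ p.1).sub (hφ p.2))) ?_)
    simpa using (cg2.add (cq.pow 2)).const_mul C
  obtain ⟨u, hu, hφu, -⟩ := exists_tendsto_eLpNorm_sub_restrict (by norm_num)
    (fun n => (hφ n).memLp 2) c2 Ω
  obtain ⟨v, hv, hφv, hvn⟩ := exists_tendsto_eLpNorm_sub_restrict hq1
    (fun n => (hφ n).memLp q) cq Ω
  obtain ⟨G, hG, hφG, hGn⟩ := exists_tendsto_eLpNorm_sub_restrict (by norm_num)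
    (fun n => (hφ n).memLp_gradient 2) cg Ω
  -- The `L²` and `L^q` limits were obtained separately. Both are limits in measure of the same
  -- sequence, so they agree.
  have huv : u =ᵐ[volume.restrict Ω] v := tendstoInMeasure_ae_unique
    (tendstoInMeasure_of_tendsto_eLpNorm (by norm_num) (fun n => ((hφ n).memLp 2).restrict Ω |>.1)
      hu.1 hφu)
    (tendstoInMeasure_of_tendsto_eLpNorm hq0 (fun n => ((hφ n).memLp q).restrict Ω |>.1)
      hv.1 hφv)
  have hv1 : eLpNorm v q (volume.restrict Ω) = 1 := by
    have h1 : lpNorm v q (volume.restrict Ω) = 1 := by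
      refine tendsto_nhds_unique hvn (tendsto_const_nhds.congr fun n => ?_)
      rw [← hφ1 n, ← toReal_eLpNorm ((hφ n).memLp q).1,
        ← toReal_eLpNorm ((hφ n).memLp q).1.restrict,
        eLpNorm_restrict_eq_of_support_subset (hφ n).support_subset]
    rw [← ofReal_lpNorm hv, h1, ENNReal.ofReal_one]
  have hu1 : eLpNorm u q (volume.restrict Ω) = 1 := (eLpNorm_congr_ae huv).trans hv1
  have hGl : lpNorm G 2 (volume.restrict Ω) ^ 2 = l := by
    refine tendsto_nhds_unique (hGn.pow 2) (hg.congr fun n => ?_)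
    rw [← toReal_eLpNorm ((hφ n).memLp_gradient 2).1,
      ← toReal_eLpNorm ((hφ n).memLp_gradient 2).1.restrict,
      eLpNorm_restrict_eq_of_support_subset (hφ n).support_gradient_subset]
  refine ⟨u, ?_, hv.ae_eq huv.symm, G, ⟨⟨?_, ?_, ?_⟩, φ, hφ, ?_, ?_⟩, ?_⟩
  · intro h0
    rw [eLpNorm_congr_ae h0] at hu1
    simp at hu1
  · simpa using hu
  · simpa using hG
  · exact isWeakGradient_of_tendsto hφ hu hG hφu hφG
  · simpa using hφu
  · simpa using hφG
  · rw [hu1, ENNReal.one_rpow, mul_one, ← ofReal_lpNorm_two_sq hG, hGl, hlof]
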